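/- **Conventions.** Manifolds are smooth, finite-dimensional, Hausdorff and second countable. A constraint $\mathbb{R}$-module $E=(E_T,E_N,E_0)$ consists of real vector spaces $E_T,E_N$, a linear map $\iota\colon E_N\to E_T$ and a subspace $E_0\subseteq E_N$; a morphism is a pair of linear maps $(\varphi_T,\varphi_N)$ with $\iota\varphi_N=\varphi_T\iota$ and $\varphi_N(E_0)\subseteq F_0$. A regular monomorphism is an equalizer in this category (equivalently: $\varphi_T,\varphi_N$ are injective and $\varphi_N^{-1}(F_0)=E_0$). The cohomology of a complex of constraint modules has $T$- and $N$-components $\ker\delta_T/\operatorname{im}\delta_T$ and $\ker\delta_N/\operatorname{im}\delta_N$, and its $0$-component consists of the classes in the $N$-component that are represented by cocycles in the $0$-component. A constraint manifold $\mathcal{M}=(M,C,D)$ is a manifold $M$ with a closed embedded submanifold $C$ and a simple distribution $D\subseteq TC$, i.e. $D=\ker T\pi$ for a surjective submersion $\pi\colon C\to Q=C/D$ onto a manifold with connected fibres (the leaves of $D$). Its constraint algebra of functions $A=\mathrm{C}C^\infty(\mathcal{M})$ has $A_T=C^\infty(M)$, $A_N=\{f : f|_C \text{ is constant along the leaves of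 } D\}$ and $A_0=\{f : f|_C=0\}$. The strong constraint $k$-vector fields $\mathfrak{X}^k_{\boxtimes}(\mathcal{M})$ have $T$-component $\Gamma^\infty(\Lambda^kTM)$; the $0$-component consists of those $X$ with $X|_C\in D\wedge\Lambda^{k-1}TM|_C$; the $N$-component consists of those $X$ with $X|_C\in\Lambda^kTC+D\wedge\Lambda^{k-1}TM|_C$ whose class in $\Lambda^k(TC/D)\cong\pi^*\Lambda^kTQ$ is parallel along the leaves, i.e. is the pull-back of a $k$-vector field on $Q$. (For $k=0$, $D\wedge\Lambda^{-1}TM=0$.) The differential constraint Hochschild complex $C^\bullet_{\mathrm{diff}}(A)$ has as $T$-component in degree $k$ the multidifferential operators $A_T^{k}\to A_T$; as $N$-component the pairs $(\varphi_T,\varphi_N)$ of multidifferential operators on $A_T$ and $A_N$ with $\iota\circ\varphi_N=\varphi_T\circ\iota^{\otimes k}$ such that $\varphi_N$ takes values in $A_0$ whenever one of its arguments is in $A_0$; as $0$-component those pairs for which all values of $\varphi_N$ are in $A_0$. Its differential is the Hochschild differential $$(\delta\varphi)(a_0,\dots,a_k)=a_0\varphi(a_1,\dots,a_k)+\sum_{i=0}^{k-1}(-1)^{i+1}\varphi(a_0,\dots,a_ia_{i+1},\dots,a_k)+(-1)^{k+1}\varphi(a_0,\dots,a_{k-1})a_k$$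 on both components, and $\mathrm{HH}^\bullet_{\mathrm{diff}}(A)$ is its cohomology. **Proposition.** Let $\mathcal{M}=(M,C,D)$ be a constraint manifold. 1. The formula $$\mathcal{U}(X)(f_1,\dots,f_k)=\frac{1}{k!}\,\mathrm{ins}_{\mathrm{d}f_1,\dots,\mathrm{d}f_k}X ,\qquad X\in\mathfrak{X}^k_{\boxtimes}(\mathcal{M}),\ k\ge 0,$$ where $\mathrm{ins}_{\alpha_1,\dots,\alpha_k}(v_1\wedge\dots\wedge v_k)=\det(\alpha_i(v_j))$, defines (on the $T$- and $N$-components) a morphism of complexes of constraint modules $\mathcal{U}\colon(\mathfrak{X}^\bullet_{\boxtimes}(\mathcal{M}),0)\to(C^\bullet_{\mathrm{diff}}(A),\delta)$. 2. The induced morphism $\mathcal{U}\colon\mathfrak{X}^\bullet_{\boxtimes}(\mathcal{M})\to\mathrm{HH}^\bullet_{\mathrm{diff}}(A)$, $X\mapsto[\mathcal{U}(X)]$, is a regular monomorphism in every degree. -/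

import Mathlib

open scoped Manifold ContDiff
open CategoryTheory

universe u v w

noncomputable section

/-! ### Constraint modules -/

/-- A constraint `ℝ`-module `E = (E_T, E_N, E_0)`: two modules `E_T`, `E_N`, a linear map
`ι : E_N → E_T` (not necessarily injective) and a submodule `E_0 ⊆ E_N`. -/
structure ConMod where
  T : Type u
  N : Type u
  [addT : AddCommGroup T]
  [addN : AddCommGroup N]
  [modT : Module ℝ T]
  [modN : Module ℝ N]
  ι : N →ₗ[ℝ] T
  zero : Submodule ℝ N

namespace ConMod

attribute [instance] ConMod.addT ConMod.addN ConMod.modT ConMod.modN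

/-- A morphism of constraint modules: linear maps on the `T`- and `N`-components which are
compatible with `ι` and preserve the `0`-components. -/
@[ext]
structure Hom (E F : ConMod.{u}) where
  T : E.T →ₗ[ℝ] F.T
  N : E.N →ₗ[ℝ] F.N
  comm : ∀ x, F.ι (N x) = T (E.ι x)
  map_zero : ∀ x ∈ E.zero, N x ∈ F.zero

instance : Category ConMod.{u} where
  Hom := Hom
  id E := ⟨LinearMap.id, LinearMap.id, fun _ => rfl, fun _ h => h⟩
  comp f g := ⟨g.T ∘ₗ f.T, g.N ∘ₗ f.N, fun x => by simp [g.comm, f.comm],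
    fun x hx => g.map_zero _ (f.map_zero x hx)⟩

@[ext]
theorem hom_ext {E F : ConMod.{u}} {f g : E ⟶ F} (hT : ∀ x, f.T x = g.T x)
    (hN : ∀ x, f.N x = g.N x) : f = g :=
  Hom.ext (LinearMap.ext hT) (LinearMap.ext hN)

@[simp] theorem comp_T {E F G : ConMod.{u}} (f : E ⟶ F) (g : F ⟶ G) (x : E.T) :
    (f ≫ g).T x = g.T (f.T x) := rfl

@[simp] theorem comp_N {E F G : ConMod.{u}} (f : E ⟶ F) (g : F ⟶ G) (x : E.N) :
    (f ≫ g).N x = g.N (f.N x) := rfl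

instance : Limits.HasZeroMorphisms ConMod.{u} where
  zero E F := ⟨⟨0, 0, fun _ => by simp, fun _ _ => F.zero.zero_mem⟩⟩
  comp_zero _ _ := rfl
  zero_comp _ _ _ f := hom_ext (fun _ => map_zero f.T) (fun _ => map_zero f.N)

@[simp] theorem zero_T {E F : ConMod.{u}} (x : E.T) : (0 : E ⟶ F).T x = 0 := rfl
@[simp] theorem zero_N {E F : ConMod.{u}} (x : E.N) : (0 : E ⟶ F).N x = 0 := rfl

/-- The embedded constraint module `(T, N, Z)` given by submodules `Z ⊆ N ⊆ T`. -/
def ofSubmodules (T : Type u) [AddCommGroup T] [Module ℝ T] (N Z : Submodule ℝ T) : ConMod.{u} where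
  T := T
  N := N
  ι := N.subtype
  zero := Z.comap N.subtype

end ConMod

/-! ### Constraint cochain complexes and their cohomology -/

/-- A cochain complex of constraint modules in non-negative degrees. -/
structure ConComplex where
  X : ℕ → ConMod.{u}
  d : ∀ n, X n ⟶ X (n + 1)
  d_comp_d : ∀ n, d n ≫ d (n + 1) = 0

namespace ConComplex

/-- A morphism of constraint complexes. -/
structure Hom (K L : ConComplex.{u}) where
  f : ∀ n, K.X n ⟶ L.X n
  comm : ∀ n, f n ≫ L.d n = K.d n ≫ f (n + 1)

/-- A graded constraint module, viewed as a complex with zero differential. -/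
def ofGraded (X : ℕ → ConMod.{u}) : ConComplex.{u} where
  X := X
  d _ := 0
  d_comp_d _ := Limits.zero_comp

variable (K : ConComplex.{u})

/-- The coboundaries in the `T`-component. -/
def boundariesT : ∀ n, Submodule ℝ (K.X n).T
  | 0 => ⊥
  | n + 1 => LinearMap.range (K.d n).T

/-- The coboundaries in the `N`-component. -/
def boundariesN : ∀ n, Submodule ℝ (K.X n).N
  | 0 => ⊥
  | n + 1 => LinearMap.range (K.d n).N

theorem boundaries_ι (n : ℕ) (x : (K.X n).N) (hx : x ∈ K.boundariesN n) :
    (K.X n).ι x ∈ K.boundariesT n := by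
  cases n with
  | zero =>
    have h0 : x = 0 := hx
    rw [h0, map_zero]
    exact Submodule.zero_mem _
  | succ n =>
    obtain ⟨y, rfl⟩ := hx
    exact ⟨(K.X n).ι y, ((K.d n).comm y).symm⟩

/-- The map induced by `ι` on cocycles. -/
def cocyclesι (n : ℕ) : LinearMap.ker (K.d n).N →ₗ[ℝ] LinearMap.ker (K.d n).T :=
  (K.X n).ι.restrict fun x hx => by
    rw [LinearMap.mem_ker] at hx ⊢
    rw [← (K.d n).comm, hx, map_zero]

/-- The cohomology of a constraint complex: in the `T`- and `N`-components it is the quotient of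
cocycles by coboundaries, and its `0`-component consists of the classes in the `N`-component which
have a cocycle representative in the `0`-component. -/
def cohomology (n : ℕ) : ConMod.{u} where
  T := LinearMap.ker (K.d n).T ⧸ (K.boundariesT n).comap (LinearMap.ker (K.d n).T).subtype
  N := LinearMap.ker (K.d n).N ⧸ (K.boundariesN n).comap (LinearMap.ker (K.d n).N).subtype
  ι := Submodule.mapQ _ _ (K.cocyclesι n) fun x hx => K.boundaries_ι n x.1 hx
  zero := ((K.X n).zero.comap (LinearMap.ker (K.d n).N).subtype).map (Submodule.mkQ _)

/-- A morphism `f : E ⟶ K.X n` with values in cocycles induces `x ↦ [f x]` into cohomology. -/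
def liftCohomology {E : ConMod.{u}} (n : ℕ) (f : E ⟶ K.X n) (hf : f ≫ K.d n = 0) :
    E ⟶ K.cohomology n where
  T := Submodule.mkQ _ ∘ₗ f.T.codRestrict (LinearMap.ker (K.d n).T) fun x => by
    rw [LinearMap.mem_ker, ← ConMod.comp_T, hf, ConMod.zero_T]
  N := Submodule.mkQ _ ∘ₗ f.N.codRestrict (LinearMap.ker (K.d n).N) fun x => by
    rw [LinearMap.mem_ker, ← ConMod.comp_N, hf, ConMod.zero_N]
  comm x := by
    refine congrArg (Submodule.mkQ _) (Subtype.ext ?_)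
    exact f.comm x
  map_zero x hx := ⟨_, f.map_zero x hx, rfl⟩

/-- The morphism `X ⟶ H(L)` induced in degree `n` by a morphism of complexes from a graded
constraint module `X` with zero differential to `L`. -/
def Hom.induced {X : ℕ → ConMod.{u}} {L : ConComplex.{u}} (U : Hom (ofGraded X) L) (n : ℕ) :
    X n ⟶ L.cohomology n :=
  L.liftCohomology n (U.f n) ((U.comm n).trans Limits.zero_comp)

end ConComplex

/-! ### The Hochschild differential of a commutative algebra and multidifferential operators -/

section Contract

variable {A : Type u} [CommRing A] {n : ℕ}

theorem contractNth_update (i : Fin n) (a : Fin (n + 1) → A) (j : Fin (n + 1)) :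
    ∃ s : A, ∀ x : A, i.castSucc.contractNth (· * ·) (Function.update a j x) =
      Function.update (i.castSucc.contractNth (· * ·) a) (i.predAbove j) (s * x) := by
  refine ⟨if j = i.castSucc then a i.succ else if j = i.succ then a i.castSucc else 1,
    fun x => funext fun k => ?_⟩
  have hp : ((i.predAbove j : Fin n) : ℕ) = if (i : ℕ) < j then (j : ℕ) - 1 else j := by
    rw [Fin.predAbove]
    split_ifs with h1 h2 h2
    · simp
    · exact absurd h1 (by simpa [Fin.lt_def] using h2)
    · exact absurd h2 (by simpa [Fin.lt_def] using h1)
    · simp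
  have hk := k.2
  have hi := i.2
  simp only [Fin.contractNth, Function.update_apply, Fin.ext_iff, hp, Fin.val_castSucc,
    Fin.val_succ]
  have e1 : (k : ℕ) = i → k = i := Fin.ext
  rcases lt_trichotomy (k : ℕ) i with h | h | h
  · split_ifs <;> first | omega | simp_all
  · have := e1 h
    subst this
    split_ifs <;> first | omega | rfl | exact mul_comm _ _
  · split_ifs <;> first | omega | simp_all

theorem contractNth_succ_cons (i : Fin n) (x : A) (a : Fin (n + 1) → A) :
    i.succ.castSucc.contractNth (· * ·) (Fin.cons x a : Fin (n + 2) → A) =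
      Fin.cons x (i.castSucc.contractNth (· * ·) a) := by
  funext k
  refine Fin.cases ?_ (fun k => ?_) k
  · simp [Fin.contractNth]
  · simp only [Fin.contractNth, Fin.val_succ, Fin.val_castSucc, Fin.cons_succ, add_lt_add_iff_right,
      add_left_inj, ← Fin.succ_castSucc]

theorem contractNth_zero_cons (x y : A) (a : Fin n → A) :
    (0 : Fin (n + 1)).castSucc.contractNth (· * ·)
      (Fin.cons x (Fin.cons y a : Fin (n + 1) → A) : Fin (n + 2) → A) = Fin.cons (x * y) a := by
  funext k
  refine Fin.cases ?_ (fun k => ?_) k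
  · simp [Fin.contractNth]
  · simp [Fin.contractNth]

theorem contractNth_snoc (i : Fin n) (z : A) (a : Fin (n + 1) → A) :
    i.castSucc.castSucc.contractNth (· * ·) (Fin.snoc a z : Fin (n + 2) → A) =
      Fin.snoc (i.castSucc.contractNth (· * ·) a) z := by
  funext k
  have hi := i.2
  refine Fin.lastCases ?_ (fun k => ?_) k
  · have h1 : ¬ n < (i : ℕ) := by omega
    have h2 : n ≠ (i : ℕ) := by omega
    simp [Fin.contractNth, h1, h2]
  · simp only [Fin.contractNth, Fin.val_castSucc, Fin.snoc_castSucc, Fin.succ_castSucc]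

theorem contractNth_last_snoc (z : A) (a : Fin (n + 1) → A) :
    (Fin.last n).castSucc.contractNth (· * ·) (Fin.snoc a z : Fin (n + 2) → A) =
      Fin.snoc (Fin.init a) (a (Fin.last n) * z) := by
  funext k
  refine Fin.lastCases ?_ (fun k => ?_) k
  · simp [Fin.contractNth]
  · simp [Fin.contractNth, Fin.init]

end Contract

section Hochschild

/-- The `n`-cochains `Hom(A^{⊗ n}, A)` of the algebra `A`. -/
abbrev Cochain (A : Type u) [CommRing A] [Algebra ℝ A] (n : ℕ) : Type u :=
  MultilinearMap ℝ (fun _ : Fin n => A) A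

variable {A : Type u} [CommRing A] [Algebra ℝ A] {n : ℕ}

/-- The cochain `(a₀, …, aₙ) ↦ a₀ φ(a₁, …, aₙ)`. -/
def leftFace : Cochain A n →ₗ[ℝ] Cochain A (n + 1) where
  toFun φ := LinearMap.uncurryLeft
    { toFun := fun x => (LinearMap.mulLeft ℝ x).compMultilinearMap φ
      map_add' := fun x y => by ext a; simp [add_mul]
      map_smul' := fun r x => by ext a; simp }
  map_add' φ ψ := by ext a; simp
  map_smul' r φ := by ext a; simp

/-- The cochain `(a₀, …, aₙ) ↦ φ(a₀, …, aₙ₋₁) aₙ`. -/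
def rightFace : Cochain A n →ₗ[ℝ] Cochain A (n + 1) where
  toFun φ := MultilinearMap.uncurryRight ((LinearMap.mul ℝ A).compMultilinearMap φ)
  map_add' φ ψ := by ext a; simp
  map_smul' r φ := by ext a; simp

/-- The cochain `(a₀, …, aₙ) ↦ φ(a₀, …, aᵢ aᵢ₊₁, …, aₙ)`. -/
def innerFace (i : Fin n) : Cochain A n →ₗ[ℝ] Cochain A (n + 1) where
  toFun φ := MultilinearMap.mk' (fun a => φ (i.castSucc.contractNth (· * ·) a))
    (fun a j x y => by
      obtain ⟨s, hs⟩ := contractNth_update i a j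
      simp only [hs, mul_add, MultilinearMap.map_update_add])
    (fun a j r x => by
      obtain ⟨s, hs⟩ := contractNth_update i a j
      simp only [hs, mul_smul_comm, MultilinearMap.map_update_smul])
  map_add' φ ψ := by ext a; simp
  map_smul' r φ := by ext a; simp

@[simp] theorem leftFace_apply (φ : Cochain A n) (a : Fin (n + 1) → A) :
    leftFace φ a = a 0 * φ (Fin.tail a) := by simp [leftFace]

@[simp] theorem rightFace_apply (φ : Cochain A n) (a : Fin (n + 1) → A) :
    rightFace φ a = φ (Fin.init a) * a (Fin.last n) := by simp [rightFace]

@[simp] theorem innerFace_apply (i : Fin n) (φ : Cochain A n) (a : Fin (n + 1) → A) :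
    innerFace i φ a = φ (i.castSucc.contractNth (· * ·) a) := by simp [innerFace]

/-- The Hochschild differential. -/
def hochschildD (A : Type u) [CommRing A] [Algebra ℝ A] (n : ℕ) :
    Cochain A n →ₗ[ℝ] Cochain A (n + 1) :=
  leftFace + ∑ i : Fin n, (-1 : ℝ) ^ (i.val + 1) • innerFace i + (-1 : ℝ) ^ (n + 1) • rightFace

/-- The classical formula `(δφ)(a₀, …, aₙ) = a₀ φ(a₁, …, aₙ)
+ ∑ᵢ (-1)ⁱ⁺¹ φ(a₀, …, aᵢ aᵢ₊₁, …, aₙ) + (-1)ⁿ⁺¹ φ(a₀, …, aₙ₋₁) aₙ`. -/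
theorem hochschildD_apply (φ : Cochain A n) (a : Fin (n + 1) → A) :
    hochschildD A n φ a = a 0 * φ (Fin.tail a)
      + ∑ i : Fin n, (-1 : ℝ) ^ (i.val + 1) • φ (i.castSucc.contractNth (· * ·) a)
      + (-1 : ℝ) ^ (n + 1) • (φ (Fin.init a) * a (Fin.last n)) := by
  simp [hochschildD, LinearMap.add_apply, LinearMap.sum_apply]

/-- The alternating sum over all products of neighbouring entries. -/
def barSum (n : ℕ) (F : (Fin n → A) → A) (a : Fin (n + 1) → A) : A :=
  ∑ i : Fin n, (-1 : ℝ) ^ (i : ℕ) • F (i.castSucc.contractNth (· * ·) a)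

theorem barSum_cons (F : (Fin (n + 1) → A) → A) (x : A) (a : Fin (n + 1) → A) :
    barSum (n + 1) F (Fin.cons x a) =
      F ((0 : Fin (n + 1)).castSucc.contractNth (· * ·) (Fin.cons x a : Fin (n + 2) → A))
        - barSum n (fun w => F (Fin.cons x w)) a := by
  simp only [barSum, Fin.sum_univ_succ, contractNth_succ_cons, Fin.val_zero, pow_zero, one_smul,
    Fin.val_succ, pow_succ, mul_neg, mul_one, neg_smul, Finset.sum_neg_distrib, sub_eq_add_neg]

theorem barSum_barSum (F : (Fin n → A) → A) (a : Fin (n + 2) → A) :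
    barSum (n + 1) (barSum n F) a = 0 := by
  induction n with
  | zero => simp [barSum]
  | succ n ih =>
    obtain ⟨x, b, rfl⟩ : ∃ x b, a = Fin.cons x b := ⟨a 0, Fin.tail a, (Fin.cons_self_tail a).symm⟩
    obtain ⟨y, c, rfl⟩ : ∃ x c, b = Fin.cons x c := ⟨b 0, Fin.tail b, (Fin.cons_self_tail b).symm⟩
    obtain ⟨z, e, rfl⟩ : ∃ x e, c = Fin.cons x e := ⟨c 0, Fin.tail c, (Fin.cons_self_tail c).symm⟩
    have hsub : ∀ (G H : (Fin (n + 1) → A) → A) w,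
        barSum (n + 1) (fun v => G v - H v) w = barSum (n + 1) G w - barSum (n + 1) H w := by
      intro G H w
      simp [barSum, smul_sub]
    have ih' := ih (fun w => F (Fin.cons x w)) (Fin.cons y (Fin.cons z e))
    rw [barSum_cons, contractNth_zero_cons, barSum_cons]
    simp only [barSum_cons F x, hsub]
    erw [ih']
    rw [barSum_cons]
    simp only [contractNth_zero_cons, mul_assoc]
    simp

/-- The bimodule extension `(a₀, …, aₙ₊₁) ↦ a₀ φ(a₁, …, aₙ) aₙ₊₁` of a cochain. -/
def barExt (φ : Cochain A n) (b : Fin (n + 2) → A) : A :=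
  b 0 * φ (fun i => b i.castSucc.succ) * b (Fin.last (n + 1))

theorem barExt_cons_snoc (φ : Cochain A n) (x z : A) (a : Fin n → A) :
    barExt φ (Fin.cons x (Fin.snoc a z : Fin (n + 1) → A) : Fin (n + 2) → A) = x * φ a * z := by
  simp only [barExt, Fin.cons_zero, Fin.cons_succ, Fin.snoc_castSucc, ← Fin.succ_last,
    Fin.snoc_last]

theorem barExt_hochschildD (φ : Cochain A n) (b : Fin (n + 3) → A) :
    barExt (hochschildD A n φ) b = barSum (n + 2) (barExt φ) b := by
  obtain ⟨x, c, rfl⟩ : ∃ x c, b = Fin.cons x c := ⟨b 0, Fin.tail b, (Fin.cons_self_tail b).symm⟩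
  obtain ⟨a, z, rfl⟩ : ∃ a z, c = Fin.snoc a z :=
    ⟨Fin.init c, c (Fin.last _), (Fin.snoc_init_self c).symm⟩
  rw [barSum, Fin.sum_univ_succ, Fin.sum_univ_castSucc, barExt_cons_snoc, hochschildD_apply]
  have h0 : (0 : Fin (n + 2)).castSucc.contractNth (· * ·)
      (Fin.cons x (Fin.snoc a z : Fin (n + 2) → A) : Fin (n + 3) → A) =
        Fin.cons (x * a 0) (Fin.snoc (Fin.tail a) z : Fin (n + 1) → A) := by
    have : (Fin.snoc a z : Fin (n + 2) → A) = Fin.cons (a 0) (Fin.snoc (Fin.tail a) z) := by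
      rw [Fin.cons_snoc_eq_snoc_cons, Fin.cons_self_tail]
    rw [this, contractNth_zero_cons]
  rw [h0]
  simp only [contractNth_succ_cons, contractNth_snoc, contractNth_last_snoc, barExt_cons_snoc,
    mul_add, add_mul, Finset.mul_sum, Finset.sum_mul, add_assoc, mul_smul_comm, smul_mul_assoc,
    Fin.val_zero, pow_zero, one_smul, Fin.val_succ, Fin.val_castSucc, Fin.val_last, mul_assoc]

theorem hochschildD_comp (φ : Cochain A n) :
    hochschildD A (n + 1) (hochschildD A n φ) = 0 := by
  ext a
  have h : ∀ (ψ : Cochain A (n + 2)),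
      barExt ψ (Fin.cons 1 (Fin.snoc a 1 : Fin (n + 3) → A)) = ψ a := by
    intro ψ
    rw [barExt_cons_snoc, one_mul, mul_one]
  rw [← h, barExt_hochschildD]
  have : barExt (hochschildD A n φ) = barSum (n + 2) (barExt φ) :=
    funext fun b => barExt_hochschildD φ b
  rw [this, barSum_barSum]
  rfl

/-- The commutator `[L_b, φ]` with multiplication by `b` in the `i`-th argument:
`(a₁, …, aₙ) ↦ b φ(a₁, …, aₙ) - φ(a₁, …, b aᵢ, …, aₙ)`. -/
def slotComm (i : Fin n) (b : A) : Cochain A n →ₗ[ℝ] Cochain A n where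
  toFun φ := b • φ - φ.compLinearMap
    (fun j => if j = i then LinearMap.mulLeft ℝ b else LinearMap.id)
  map_add' φ ψ := by ext a; simp; ring
  map_smul' r φ := by ext a; simp [smul_sub]

theorem slotComm_apply (i : Fin n) (b : A) (φ : Cochain A n) (a : Fin n → A) :
    slotComm i b φ a = b * φ a - φ (Function.update a i (b * a i)) := by
  simp only [slotComm, LinearMap.coe_mk, AddHom.coe_mk, sub_apply,
    smul_apply, smul_eq_mul, MultilinearMap.compLinearMap_apply]
  congr 2
  funext j
  by_cases h : j = i
  · subst h; simp
  · simp [h]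

/-- `diffOrd i r` is the space of cochains which are differential operators of order `< r` in their
`i`-th argument (with the other arguments fixed), in the algebraic sense: `0` is the only operator
of order `< 0`, and `φ` has order `< r + 1` if all its commutators with multiplications by
elements of `A` in the `i`-th argument have order `< r`. -/
def diffOrd (i : Fin n) : ℕ → Submodule ℝ (Cochain A n)
  | 0 => ⊥
  | r + 1 => ⨅ b : A, (diffOrd i r).comap (slotComm i b)

theorem mem_diffOrd_succ (i : Fin n) (r : ℕ) (φ : Cochain A n) :
    φ ∈ diffOrd i (r + 1) ↔ ∀ b, slotComm i b φ ∈ diffOrd i r := by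
  simp [diffOrd]

theorem diffOrd_mono (i : Fin n) : Monotone (diffOrd (A := A) i) := by
  refine monotone_nat_of_le_succ fun r => ?_
  induction r with
  | zero => exact bot_le
  | succ r ih =>
    intro φ hφ
    rw [mem_diffOrd_succ] at hφ ⊢
    exact fun b => ih (hφ b)

/-- The multidifferential operators `A × … × A → A`: for some orders `K = (K₁, …, Kₙ)`, the cochain
is a differential operator of order at most `Kᵢ` in its `i`-th argument, for every `i`. -/
def multiDiff (A : Type u) [CommRing A] [Algebra ℝ A] (n : ℕ) : Submodule ℝ (Cochain A n) where
  carrier := {φ | ∃ K : Fin n → ℕ, ∀ i, φ ∈ diffOrd i (K i + 1)}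
  zero_mem' := ⟨0, fun _ => Submodule.zero_mem _⟩
  add_mem' := by
    rintro φ ψ ⟨K, hK⟩ ⟨L, hL⟩
    exact ⟨fun i => K i + L i, fun i => Submodule.add_mem _
      (diffOrd_mono i (Nat.succ_le_succ (Nat.le_add_right _ _)) (hK i))
      (diffOrd_mono i (Nat.succ_le_succ (Nat.le_add_left _ _)) (hL i))⟩
  smul_mem' := by
    rintro r φ ⟨K, hK⟩
    exact ⟨K, fun i => Submodule.smul_mem _ r (hK i)⟩

theorem face_mem_diffOrd (F : Cochain A n →ₗ[ℝ] Cochain A (n + 1)) (j : Fin (n + 1)) (l : Fin n)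
    (h : ∀ b φ, slotComm j b (F φ) = F (slotComm l b φ)) (r : ℕ) (φ : Cochain A n)
    (hφ : φ ∈ diffOrd l r) : F φ ∈ diffOrd j r := by
  induction r generalizing φ with
  | zero =>
    have h0 : φ = 0 := hφ
    rw [h0, map_zero]
    exact Submodule.zero_mem _
  | succ r ih =>
    rw [mem_diffOrd_succ] at hφ ⊢
    intro b
    rw [h]
    exact ih _ (hφ b)

theorem leftFace_mem {φ : Cochain A n} (hφ : φ ∈ multiDiff A n) :
    leftFace φ ∈ multiDiff A (n + 1) := by
  obtain ⟨K, hK⟩ := hφ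
  refine ⟨Fin.cons 0 K, fun j => ?_⟩
  refine Fin.cases ?_ (fun l => ?_) j
  · rw [mem_diffOrd_succ]
    intro b
    have : slotComm 0 b (leftFace φ) = 0 := by
      ext a
      simp [slotComm_apply, mul_assoc]
    rw [this]
    exact Submodule.zero_mem _
  · rw [Fin.cons_succ]
    refine face_mem_diffOrd leftFace l.succ l (fun b ψ => ?_) _ φ (hK l)
    ext a
    simp only [slotComm_apply, leftFace_apply, Fin.tail_update_succ]
    rw [Function.update_of_ne (Fin.succ_ne_zero l).symm]
    simp only [Fin.tail]
    ring

theorem rightFace_mem {φ : Cochain A n} (hφ : φ ∈ multiDiff A n) :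
    rightFace φ ∈ multiDiff A (n + 1) := by
  obtain ⟨K, hK⟩ := hφ
  refine ⟨Fin.snoc K 0, fun j => ?_⟩
  refine Fin.lastCases ?_ (fun l => ?_) j
  · rw [mem_diffOrd_succ]
    intro b
    have : slotComm (Fin.last n) b (rightFace φ) = 0 := by
      ext a
      simp only [slotComm_apply, rightFace_apply, Fin.init_update_last, Function.update_self,
        zero_apply]
      ring
    rw [this]
    exact Submodule.zero_mem _
  · rw [Fin.snoc_castSucc]
    refine face_mem_diffOrd rightFace l.castSucc l (fun b ψ => ?_) _ φ (hK l)
    ext a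
    simp only [slotComm_apply, rightFace_apply, Fin.init_update_castSucc]
    rw [Function.update_of_ne (Fin.castSucc_lt_last l).ne']
    simp only [Fin.init]
    ring

theorem innerFace_mem (i : Fin n) {φ : Cochain A n} (hφ : φ ∈ multiDiff A n) :
    innerFace i φ ∈ multiDiff A (n + 1) := by
  obtain ⟨K, hK⟩ := hφ
  refine ⟨fun j => K (i.predAbove j), fun j => ?_⟩
  refine face_mem_diffOrd (innerFace i) j (i.predAbove j) (fun b ψ => ?_) _ φ (hK _)
  ext a
  obtain ⟨s, hs⟩ := contractNth_update i a j
  have h1 := congrFun (hs (a j)) (i.predAbove j)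
  rw [Function.update_eq_self, Function.update_self] at h1
  simp only [slotComm_apply, innerFace_apply, hs, h1, mul_left_comm s b]

theorem hochschildD_mem {φ : Cochain A n} (hφ : φ ∈ multiDiff A n) :
    hochschildD A n φ ∈ multiDiff A (n + 1) := by
  simp only [hochschildD, LinearMap.add_apply, LinearMap.sum_apply, LinearMap.smul_apply]
  exact Submodule.add_mem _ (Submodule.add_mem _ (leftFace_mem hφ)
    (Submodule.sum_mem _ fun i _ => Submodule.smul_mem _ _ (innerFace_mem i hφ)))
    (Submodule.smul_mem _ _ (rightFace_mem hφ))
end Hochschild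

/-! ### Commutative constraint algebras and the differential constraint Hochschild complex -/

/-- A commutative constraint algebra: commutative algebras `A_T`, `A_N`, an algebra morphism
`ι : A_N → A_T` and an ideal `A_0 ⊆ A_N`. -/
structure ConAlg where
  T : Type u
  N : Type u
  [ringT : CommRing T]
  [ringN : CommRing N]
  [algT : Algebra ℝ T]
  [algN : Algebra ℝ N]
  ι : N →ₐ[ℝ] T
  zero : Ideal N

namespace ConAlg

attribute [instance] ConAlg.ringT ConAlg.ringN ConAlg.algT ConAlg.algN

variable (A : ConAlg.{u}) (n : ℕ)

/-- The `N`-component of the module of constraint `n`-cochains, i.e. the morphisms of constraint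
modules from the `n`-fold tensor power of `A` to `A`: pairs `(φ_T, φ_N)` of cochains which are
compatible with `ι` and such that `φ_N` takes values in `A_0` as soon as one of its arguments
lies in `A_0`. -/
def conCochains : Submodule ℝ (Cochain A.T n × Cochain A.N n) where
  carrier := {φ | (∀ a : Fin n → A.N, A.ι (φ.2 a) = φ.1 fun i => A.ι (a i)) ∧
    ∀ a : Fin n → A.N, (∃ i, a i ∈ A.zero) → φ.2 a ∈ A.zero}
  zero_mem' := ⟨fun _ => map_zero A.ι, fun _ _ => A.zero.zero_mem⟩
  add_mem' := by
    rintro φ ψ ⟨h1, h2⟩ ⟨h3, h4⟩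
    refine ⟨fun a => ?_, fun a ha => A.zero.add_mem (h2 a ha) (h4 a ha)⟩
    have := congrArg₂ (· + ·) (h1 a) (h3 a)
    exact (map_add A.ι _ _).trans this
  smul_mem' := by
    rintro r φ ⟨h1, h2⟩
    refine ⟨fun a => ?_, fun a ha => Submodule.smul_of_tower_mem A.zero r (h2 a ha)⟩
    exact (map_smul A.ι r _).trans (congrArg (r • ·) (h1 a))

/-- The `N`-component of the differential constraint `n`-cochains. -/
def conDiffCochains : Submodule ℝ (Cochain A.T n × Cochain A.N n) :=
  A.conCochains n ⊓ (multiDiff A.T n).prod (multiDiff A.N n)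

/-- The `0`-component: constraint cochains `(φ_T, φ_N)` such that `φ_N` takes values in `A_0`. -/
def zeroCochains : Submodule ℝ (Cochain A.T n × Cochain A.N n) where
  carrier := {φ | ∀ a : Fin n → A.N, φ.2 a ∈ A.zero}
  zero_mem' _ := A.zero.zero_mem
  add_mem' h1 h2 a := A.zero.add_mem (h1 a) (h2 a)
  smul_mem' r _ h a := Submodule.smul_of_tower_mem A.zero r (h a)

/-- The constraint module of differential constraint Hochschild `n`-cochains of `A`. -/
def diffCochains : ConMod.{u} where
  T := multiDiff A.T n
  N := A.conDiffCochains n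
  ι := ((LinearMap.fst ℝ _ _) ∘ₗ (A.conDiffCochains n).subtype).codRestrict (multiDiff A.T n)
    fun φ => φ.2.2.1
  zero := (A.zeroCochains n).comap (A.conDiffCochains n).subtype

variable {A n}

theorem hochschildD_ι {φ : Cochain A.T n × Cochain A.N n}
    (h : ∀ a : Fin n → A.N, A.ι (φ.2 a) = φ.1 fun i => A.ι (a i)) (a : Fin (n + 1) → A.N) :
    A.ι (hochschildD A.N n φ.2 a) = hochschildD A.T n φ.1 fun i => A.ι (a i) := by
  have hc : ∀ i : Fin n, (fun k => A.ι (i.castSucc.contractNth (· * ·) a k)) =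
      i.castSucc.contractNth (· * ·) (fun k => A.ι (a k)) := fun i =>
    Fin.comp_contractNth (· * ·) (· * ·) (map_mul A.ι) i.castSucc a
  simp only [hochschildD_apply, map_add, map_sum, map_smul, map_mul, h, hc]
  rfl

theorem hochschildD_zero {φ : Cochain A.N n}
    (h : ∀ a : Fin n → A.N, (∃ i, a i ∈ A.zero) → φ a ∈ A.zero) (a : Fin (n + 1) → A.N)
    (ha : ∃ i, a i ∈ A.zero) : hochschildD A.N n φ a ∈ A.zero := by
  obtain ⟨j, hj⟩ := ha
  rw [hochschildD_apply]
  refine A.zero.add_mem (A.zero.add_mem ?_ (A.zero.sum_mem fun i _ =>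
    Submodule.smul_of_tower_mem A.zero _ (h _ ?_))) (Submodule.smul_of_tower_mem A.zero _ ?_)
  · refine Fin.cases (motive := fun j => a j ∈ A.zero → _) ?_ (fun l => ?_) j hj
    · exact fun h0 => A.zero.mul_mem_right _ h0
    · exact fun hl => A.zero.mul_mem_left _ (h _ ⟨l, hl⟩)
  · obtain ⟨s, hs⟩ := contractNth_update i a j
    refine ⟨i.predAbove j, ?_⟩
    have h1 := congrFun (hs (a j)) (i.predAbove j)
    rw [Function.update_eq_self, Function.update_self] at h1
    rw [h1]
    exact A.zero.mul_mem_left _ hj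
  · refine Fin.lastCases (motive := fun j => a j ∈ A.zero → _) ?_ (fun l => ?_) j hj
    · exact fun h0 => A.zero.mul_mem_left _ h0
    · exact fun hl => A.zero.mul_mem_right _ (h _ ⟨l, hl⟩)

theorem hochschildD_all_zero {φ : Cochain A.N n} (h : ∀ a : Fin n → A.N, φ a ∈ A.zero)
    (a : Fin (n + 1) → A.N) : hochschildD A.N n φ a ∈ A.zero := by
  rw [hochschildD_apply]
  exact A.zero.add_mem (A.zero.add_mem (A.zero.mul_mem_left _ (h _)) (A.zero.sum_mem fun i _ =>
    Submodule.smul_of_tower_mem A.zero _ (h _)))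
    (Submodule.smul_of_tower_mem A.zero _ (A.zero.mul_mem_right _ (h _)))

variable (A)

/-- The differential constraint Hochschild complex `(C_diff(A), δ)` with
`δ_T = δ^{A_T}` and `δ_N = (δ^{A_T}, δ^{A_N})`. -/
def diffHochschild : ConComplex.{u} where
  X := A.diffCochains
  d _ :=
    { T := (hochschildD A.T _).restrict fun _ h => hochschildD_mem h
      N := ((hochschildD A.T _).prodMap (hochschildD A.N _)).restrict
        fun _ h => ⟨⟨hochschildD_ι h.1.1, hochschildD_zero h.1.2⟩,
          hochschildD_mem h.2.1, hochschildD_mem h.2.2⟩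
      comm := fun _ => rfl
      map_zero := fun _ h => hochschildD_all_zero h }
  d_comp_d _ := ConMod.hom_ext (fun φ => Subtype.ext (hochschildD_comp φ.1))
    (fun φ => Subtype.ext (Prod.ext (hochschildD_comp φ.1.1) (hochschildD_comp φ.1.2)))

end ConAlg

/-! ### Constraint manifolds, their functions and their multivector fields -/

/-- The differential of a smooth function at a point, as a covector. -/
def covectorAt {m : ℕ} {M : Type u} [TopologicalSpace M]
    [ChartedSpace (EuclideanSpace ℝ (Fin m)) M] (f : C^∞⟮𝓡 m, M; ℝ⟯) (p : M) :
    Module.Dual ℝ (TangentSpace (𝓡 m) p) :=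
  (mfderiv (𝓡 m) 𝓘(ℝ, ℝ) f p).toLinearMap

/-- The evaluation `ins_{α₁, …, α_k} X` of a `k`-vector on `k` covectors, which on decomposable
`k`-vectors is `ins_{α₁, …, α_k} (v₁ ∧ ⋯ ∧ v_k) = det (αᵢ(vⱼ))`. -/
def insertCovectors {V : Type*} [AddCommGroup V] [Module ℝ V] {k : ℕ}
    (α : Fin k → Module.Dual ℝ V) : ⋀[ℝ]^k V →ₗ[ℝ] ℝ :=
  exteriorPower.pairingDual ℝ V k (exteriorPower.ιMulti ℝ k α)

/-- The `k`-vector fields on `M`: smooth sections of `Λ^k TM`, smoothness meaning that the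
components with respect to the coordinate frames of all charts are smooth. -/
def multivectorFields (m : ℕ) (M : Type u) [TopologicalSpace M]
    [ChartedSpace (EuclideanSpace ℝ (Fin m)) M] (k : ℕ) :
    Submodule ℝ (∀ p : M, ⋀[ℝ]^k (TangentSpace (𝓡 m) p)) where
  carrier := {X | ∀ (p₀ : M) (α : Fin k → Module.Dual ℝ (EuclideanSpace ℝ (Fin m))),
    ContMDiffOn (𝓡 m) 𝓘(ℝ, ℝ) ∞
      (fun p => insertCovectors (fun i => (α i) ∘ₗ (mfderiv (𝓡 m)
        𝓘(ℝ, EuclideanSpace ℝ (Fin m)) (extChartAt (𝓡 m) p₀) p).toLinearMap) (X p))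
      (extChartAt (𝓡 m) p₀).source}
  zero_mem' p₀ α := by
    simp only [Pi.zero_apply, map_zero]
    exact contMDiffOn_const
  add_mem' h1 h2 p₀ α := by
    simp only [Pi.add_apply, map_add]
    exact (h1 p₀ α).add (h2 p₀ α)
  smul_mem' r X h p₀ α := by
    simp only [Pi.smul_apply, map_smul]
    exact (contMDiffOn_const (c := r)).mul (h p₀ α)

section ReducesTo

variable {V W P : Type*} [AddCommGroup V] [Module ℝ V] [AddCommGroup W] [Module ℝ W]
  [AddCommGroup P] [Module ℝ P] {k : ℕ}

/-- Given linear maps `i : W → V` and `π : W → P`, the `k`-vector `z` of `V` is congruent modulo `S`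
to (the image of) a `k`-vector of `W` which is mapped to `y` by `π`. -/
def ReducesTo (S : Submodule ℝ (⋀[ℝ]^k V)) (i : W →ₗ[ℝ] V) (π : W →ₗ[ℝ] P) (z : ⋀[ℝ]^k V)
    (y : ⋀[ℝ]^k P) : Prop :=
  ∃ ξ : ⋀[ℝ]^k W, z - exteriorPower.map k i ξ ∈ S ∧ exteriorPower.map k π ξ = y

variable {S : Submodule ℝ (⋀[ℝ]^k V)} {i : W →ₗ[ℝ] V} {π : W →ₗ[ℝ] P}

theorem ReducesTo.of_mem {z : ⋀[ℝ]^k V} (h : z ∈ S) : ReducesTo S i π z 0 :=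
  ⟨0, by rwa [map_zero, sub_zero], map_zero _⟩

theorem ReducesTo.add {z z' : ⋀[ℝ]^k V} {y y' : ⋀[ℝ]^k P} (h : ReducesTo S i π z y)
    (h' : ReducesTo S i π z' y') : ReducesTo S i π (z + z') (y + y') := by
  obtain ⟨ξ, h1, rfl⟩ := h
  obtain ⟨ξ', h1', rfl⟩ := h'
  refine ⟨ξ + ξ', ?_, map_add _ _ _⟩
  rw [map_add, add_sub_add_comm]
  exact S.add_mem h1 h1'

theorem ReducesTo.smul {z : ⋀[ℝ]^k V} {y : ⋀[ℝ]^k P} (r : ℝ) (h : ReducesTo S i π z y) :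
    ReducesTo S i π (r • z) (r • y) := by
  obtain ⟨ξ, h1, rfl⟩ := h
  refine ⟨r • ξ, ?_, map_smul _ _ _⟩
  rw [map_smul]
  exact (smul_sub r z (exteriorPower.map k i ξ)) ▸ S.smul_mem r h1

end ReducesTo

/-- A constraint manifold `(M, C, D)`: a closed embedded submanifold `C` of the manifold `M`
together with a simple distribution `D` on `C`, that is, the leaf space `Q = C / D` is a manifold
such that the projection `C → Q` is a surjective submersion; the leaves of `D` are then the fibres
of this projection, which are connected, and `D` is its vertical bundle. -/
structure ConstraintManifold (m c q : ℕ) (M : Type u) (C : Type v) (Q : Type w)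
    [TopologicalSpace M] [ChartedSpace (EuclideanSpace ℝ (Fin m)) M]
    [TopologicalSpace C] [ChartedSpace (EuclideanSpace ℝ (Fin c)) C]
    [TopologicalSpace Q] [ChartedSpace (EuclideanSpace ℝ (Fin q)) Q] where
  /-- the inclusion of the submanifold -/
  incl : C → M
  isSmoothEmbedding_incl : Manifold.IsSmoothEmbedding (𝓡 c) (𝓡 m) ∞ incl
  isClosed_range_incl : IsClosed (Set.range incl)
  /-- the distribution -/
  D : ∀ x : C, Submodule ℝ (TangentSpace (𝓡 c) x)
  /-- the projection onto the leaf space -/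
  proj : C → Q
  isSubmersion_proj : Manifold.IsSubmersion (𝓡 c) (𝓡 q) ∞ proj
  isConnected_fibre : ∀ y : Q, IsConnected (proj ⁻¹' {y})
  D_eq : ∀ x : C, D x = LinearMap.ker (mfderiv (𝓡 c) (𝓡 q) proj x).toLinearMap

namespace ConstraintManifold

variable {m c q : ℕ} {M : Type u} {C : Type v} {Q : Type w}
  [TopologicalSpace M] [ChartedSpace (EuclideanSpace ℝ (Fin m)) M]
  [TopologicalSpace C] [ChartedSpace (EuclideanSpace ℝ (Fin c)) C]
  [TopologicalSpace Q] [ChartedSpace (EuclideanSpace ℝ (Fin q)) Q]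
  (𝓜 : ConstraintManifold m c q M C Q)

/-- The functions on `M` whose restriction to `C` is constant along the leaves of `D`. -/
def functionsN : Subalgebra ℝ C^∞⟮𝓡 m, M; ℝ⟯ where
  carrier := {f | ∀ x y : C, 𝓜.proj x = 𝓜.proj y → f (𝓜.incl x) = f (𝓜.incl y)}
  mul_mem' hf hg x y h := congrArg₂ (· * ·) (hf x y h) (hg x y h)
  add_mem' hf hg x y h := congrArg₂ (· + ·) (hf x y h) (hg x y h)
  algebraMap_mem' _ _ _ _ := rfl

/-- The constraint algebra of functions: all smooth functions on `M`, those whose restriction to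
`C` is constant along the leaves of `D`, and those vanishing on `C`. -/
abbrev functions : ConAlg.{u} where
  T := C^∞⟮𝓡 m, M; ℝ⟯
  N := 𝓜.functionsN
  ι := 𝓜.functionsN.val
  zero :=
    { carrier := {f | ∀ x : C, f.1 (𝓜.incl x) = 0}
      zero_mem' := fun _ => rfl
      add_mem' := fun hf hg x => (congrArg₂ (· + ·) (hf x) (hg x)).trans (add_zero 0)
      smul_mem' := fun f _ hg x =>
        (congrArg (f.1 (𝓜.incl x) * ·) (hg x)).trans (mul_zero _) }

/-- The inclusion `T_x C → T_x M`. -/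
def inclT (x : C) : TangentSpace (𝓡 c) x →ₗ[ℝ] TangentSpace (𝓡 m) (𝓜.incl x) :=
  (mfderiv (𝓡 c) (𝓡 m) 𝓜.incl x).toLinearMap

/-- The projection `T_x C → T_x C / D_x = T_{proj x} Q`. -/
def projT (x : C) : TangentSpace (𝓡 c) x →ₗ[ℝ] TangentSpace (𝓡 q) (𝓜.proj x) :=
  (mfderiv (𝓡 c) (𝓡 q) 𝓜.proj x).toLinearMap

/-- The subspace `D_x ∧ Λ^{k-1} T_x M` of `Λ^k T_x M`, spanned by the `v₁ ∧ ⋯ ∧ v_k` with at least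
one `vⱼ` in `D_x`. It is zero for `k = 0`. -/
def wedgeD (k : ℕ) (x : C) : Submodule ℝ (⋀[ℝ]^k (TangentSpace (𝓡 m) (𝓜.incl x))) :=
  Submodule.span ℝ {z | ∃ v : Fin k → TangentSpace (𝓡 m) (𝓜.incl x),
    (∃ j, v j ∈ (𝓜.D x).map (𝓜.inclT x)) ∧ z = exteriorPower.ιMulti ℝ k v}

/-- The `0`-component of the strong constraint `k`-vector fields: along `C` they take values in
`D ∧ Λ^{k-1} TM`. -/
def multivectorsZero (k : ℕ) : Submodule ℝ (multivectorFields m M k) where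
  carrier := {X | ∀ x : C, X.1 (𝓜.incl x) ∈ 𝓜.wedgeD k x}
  zero_mem' _ := Submodule.zero_mem _
  add_mem' h1 h2 x := Submodule.add_mem _ (h1 x) (h2 x)
  smul_mem' r _ h x := Submodule.smul_mem _ r (h x)

/-- The `N`-component of the strong constraint `k`-vector fields: along `C` they take values in
`Λ^k TC + D ∧ Λ^{k-1} TM`, and the induced section of `Λ^k (TC / D) = proj^* (Λ^k TQ)` is parallel
along the leaves (for the Bott connection), i.e. it is the pull-back of a `k`-vector field `Y` on
the leaf space `Q`. -/
def multivectorsN (k : ℕ) : Submodule ℝ (multivectorFields m M k) where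
  carrier := {X | ∃ Y : multivectorFields q Q k, ∀ x : C,
    ReducesTo (𝓜.wedgeD k x) (𝓜.inclT x) (𝓜.projT x) (X.1 (𝓜.incl x)) (Y.1 (𝓜.proj x))}
  zero_mem' := ⟨0, fun _ => ReducesTo.of_mem (Submodule.zero_mem _)⟩
  add_mem' := by
    rintro X X' ⟨Y, h⟩ ⟨Y', h'⟩
    exact ⟨Y + Y', fun x => (h x).add (h' x)⟩
  smul_mem' := by
    rintro r X ⟨Y, h⟩
    exact ⟨r • Y, fun x => (h x).smul r⟩

theorem multivectorsZero_le (k : ℕ) : 𝓜.multivectorsZero k ≤ 𝓜.multivectorsN k := fun _ h =>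
  ⟨0, fun x => ReducesTo.of_mem (h x)⟩

/-- The constraint module of strong constraint `k`-vector fields, i.e. of constraint sections of
the `k`-th exterior power of the constraint tangent bundle with respect to the strong tensor
product. -/
def multivectors (k : ℕ) : ConMod.{u} :=
  ConMod.ofSubmodules (multivectorFields m M k) (𝓜.multivectorsN k) (𝓜.multivectorsZero k)

end ConstraintManifold

end

/-! The cochain 𝒰(X) is an alternating multiderivation, and the Leibniz rule makes its Hochschild
differential telescope to zero. Compatibility with the constraint structure is a pointwise fact
along C (`insertCovectors_of_reducesTo`). A function in A_N restricts on C to the pull-back of a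
function on Q, so its differential kills D. Pairing X with such differentials is therefore the same
as pairing the reduced field Y on Q with the differentials of the descended functions. Hence the
values are constant along leaves, vanish on C when one argument does, and vanish on C when X lies in
the 0-component.

On cohomology, antisymmetrization inverts 𝒰 up to a scalar: it kills every coboundary because the
algebras are commutative (`alternatization_hochschildD`), and it multiplies the alternating cochain
𝒰(X) by k!. So [𝒰(X)] = 0 forces 𝒰(X) = 0, and then X = 0 because differentials of functions exhaust
all covectors. Injectivity on N follows from injectivity on T.

A regular monomorphism must also reflect the 0-component. If [𝒰(X)] has a representative with values
in A_0, antisymmetrizing over A_N shows that 𝒰(X)_N itself has values in A_0. Every covector on Q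
comes from a function in A_N (`exists_lift`), so Y = 0. Since the kernel of Λ^k TC → Λ^k TQ is
spanned by wedges with a factor in D (`mem_wedgeSpan_ker_of_map_eq_zero`), X then lies in D ∧
Λ^{k-1} TM along C (`mem_multivectorsZero`). -/

noncomputable section

open scoped Topology

/-! ### Regular monomorphisms of constraint modules -/

namespace ConMod

/-- The cokernel of `f` in the `T`- and `N`-components, with the largest possible `0`-component. -/
abbrev quotientRange {E F : ConMod.{u}} (f : E ⟶ F) : ConMod.{u} where
  T := F.T ⧸ LinearMap.range f.T
  N := F.N ⧸ LinearMap.range f.N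
  ι := Submodule.mapQ _ _ F.ι <| by
    rintro _ ⟨x, rfl⟩
    exact ⟨E.ι x, (f.comm x).symm⟩
  zero := ⊤

/-- The projection onto the cokernel. -/
def toQuotientRange {E F : ConMod.{u}} (f : E ⟶ F) : F ⟶ quotientRange f where
  T := Submodule.mkQ _
  N := Submodule.mkQ _
  comm _ := rfl
  map_zero _ _ := Submodule.mem_top

/-- A morphism of constraint modules which is injective in the `T`- and `N`-components and reflects
the `0`-component is a regular monomorphism. -/
theorem isRegularMono_of_injective {E F : ConMod.{u}} (f : E ⟶ F)
    (hT : Function.Injective f.T) (hN : Function.Injective f.N)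
    (h0 : ∀ x, f.N x ∈ F.zero → x ∈ E.zero) : IsRegularMono f := by
  have w : f ≫ toQuotientRange f = f ≫ 0 := by
    refine hom_ext (fun x => ?_) (fun x => ?_)
    · exact (Submodule.Quotient.mk_eq_zero _).2 ⟨x, rfl⟩
    · exact (Submodule.Quotient.mk_eq_zero _).2 ⟨x, rfl⟩
  -- The morphism `f` is the equalizer of the cokernel projection and zero. A competing cone has
  -- values in the ranges of `f.T` and `f.N`, where `f` can be inverted.
  refine ⟨⟨⟨quotientRange f, toQuotientRange f, 0, w, ?_⟩⟩⟩
  refine Limits.Fork.IsLimit.mk' _ fun s => ?_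
  have rT : ∀ x, s.ι.T x ∈ LinearMap.range f.T := fun x =>
    (Submodule.Quotient.mk_eq_zero _).1 <|
      congrArg (fun g : s.pt ⟶ quotientRange f => g.T x) s.condition
  have rN : ∀ x, s.ι.N x ∈ LinearMap.range f.N := fun x =>
    (Submodule.Quotient.mk_eq_zero _).1 <|
      congrArg (fun g : s.pt ⟶ quotientRange f => g.N x) s.condition
  let eT := LinearEquiv.ofInjective f.T hT
  let eN := LinearEquiv.ofInjective f.N hN
  have hlT : ∀ x, f.T (eT.symm ⟨s.ι.T x, rT x⟩) = s.ι.T x := fun x =>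
    congrArg Subtype.val (eT.apply_symm_apply ⟨s.ι.T x, rT x⟩)
  have hlN : ∀ x, f.N (eN.symm ⟨s.ι.N x, rN x⟩) = s.ι.N x := fun x =>
    congrArg Subtype.val (eN.apply_symm_apply ⟨s.ι.N x, rN x⟩)
  let l : s.pt ⟶ E :=
    { T := eT.symm.toLinearMap ∘ₗ s.ι.T.codRestrict _ rT
      N := eN.symm.toLinearMap ∘ₗ s.ι.N.codRestrict _ rN
      comm := fun x => hT <| by
        refine (f.comm _).symm.trans ?_
        refine (congrArg F.ι (hlN x)).trans ?_
        exact (s.ι.comm x).trans (hlT _).symm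
      -- Injectivity alone would not make the lift preserve 0-components; this is where reflection
      -- enters.
      map_zero := fun x hx => h0 _ <| by
        have := s.ι.map_zero x hx
        rw [← hlN x] at this
        exact this }
  refine ⟨l, hom_ext hlT hlN, fun {m} hm => hom_ext (fun x => hT ?_) (fun x => hN ?_)⟩
  · exact (congrArg (fun g : s.pt ⟶ F => g.T x) hm).trans (hlT x).symm
  · exact (congrArg (fun g : s.pt ⟶ F => g.N x) hm).trans (hlN x).symm

end ConMod

/-! ### Multiderivations and antisymmetrization -/

section Multiderivation

variable {A : Type u} {n : ℕ}

theorem update_removeNth_succ (i : Fin n) (a : Fin (n + 1) → A) :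
    Function.update (i.succ.removeNth a) i (a i.succ) = i.castSucc.removeNth a := by
  funext k
  rcases lt_trichotomy k i with h | rfl | h
  · rw [Function.update_of_ne h.ne, Fin.removeNth_apply, Fin.removeNth_apply,
      Fin.succAbove_of_castSucc_lt _ _ (by rw [Fin.lt_def] at *; simp; omega),
      Fin.succAbove_of_castSucc_lt _ _ (by simpa using h)]
  · simp [Fin.removeNth_apply]
  · rw [Function.update_of_ne h.ne', Fin.removeNth_apply, Fin.removeNth_apply,
      Fin.succAbove_of_le_castSucc _ _ (by rw [Fin.lt_def] at *; rw [Fin.le_def]; simp; omega),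
      Fin.succAbove_of_le_castSucc _ _ (by simpa using h.le)]

theorem update_removeNth_castSucc (i : Fin n) (a : Fin (n + 1) → A) :
    Function.update (i.succ.removeNth a) i (a i.castSucc) = i.succ.removeNth a := by
  rw [Function.update_eq_self_iff]
  simp [Fin.removeNth_apply]

variable [CommRing A]

/-- This form isolates the product in a single slot, so that the Leibniz rule applies to an inner
face. The two resulting terms omit one of the two neighbouring entries each, by the
`update_removeNth` lemmas. -/
theorem contractNth_castSucc_eq_update (i : Fin n) (a : Fin (n + 1) → A) :
    i.castSucc.contractNth (· * ·) a =
      Function.update (i.succ.removeNth a) i (a i.castSucc * a i.succ) := by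
  funext k
  rcases lt_trichotomy k i with h | rfl | h
  · rw [Fin.contractNth_apply_of_lt _ _ _ _ (by simpa using h), Function.update_of_ne h.ne,
      Fin.removeNth_apply, Fin.succAbove_of_castSucc_lt _ _ (by rw [Fin.lt_def] at *; simp; omega)]
  · rw [Fin.contractNth_apply_of_eq _ _ _ _ (by simp), Function.update_self]
  · rw [Fin.contractNth_apply_of_gt _ _ _ _ (by simpa using h), Function.update_of_ne h.ne',
      Fin.removeNth_apply, Fin.succAbove_of_le_castSucc _ _
        (by rw [Fin.lt_def] at *; rw [Fin.le_def]; simp; omega)]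

theorem contractNth_comp_swap (i : Fin n) (a : Fin (n + 1) → A) :
    i.castSucc.contractNth (· * ·) (a ∘ Equiv.swap i.castSucc i.succ) =
      i.castSucc.contractNth (· * ·) a := by
  have hne : i.castSucc ≠ i.succ := (Fin.castSucc_lt_succ).ne
  simp only [contractNth_castSucc_eq_update, Function.comp_apply, Equiv.swap_apply_left,
    Equiv.swap_apply_right, mul_comm (a i.succ)]
  funext k
  by_cases hk : k = i
  · subst hk
    simp
  · rw [Function.update_of_ne hk, Function.update_of_ne hk, Fin.removeNth_apply,
      Fin.removeNth_apply, Function.comp_apply, Equiv.swap_apply_of_ne_of_ne]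
    · intro h
      apply hk
      rw [← Fin.succAbove_succ_self i] at h
      exact Fin.succAbove_right_injective h
    · exact Fin.succAbove_ne _ _

variable [Algebra ℝ A]

/-- A cochain which satisfies the Leibniz rule in each of its arguments. -/
def IsMultiderivation (φ : Cochain A n) : Prop :=
  ∀ (a : Fin n → A) (i : Fin n) (x y : A), φ (Function.update a i (x * y)) =
    x * φ (Function.update a i y) + y * φ (Function.update a i x)

/-- By Leibniz, the commutator with b in slot i is -aᵢ φ(…, b, …), which is A-linear in aᵢ. A second
commutator therefore vanishes, and φ has order at most 1 in each slot. -/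
theorem IsMultiderivation.mem_multiDiff {φ : Cochain A n} (h : IsMultiderivation φ) :
    φ ∈ multiDiff A n := by
  refine ⟨fun _ => 1, fun i => ?_⟩
  rw [mem_diffOrd_succ]
  intro b
  rw [mem_diffOrd_succ]
  intro c
  have : slotComm i c (slotComm i b φ) = 0 := by
    ext a
    have h1 := h a i b (a i)
    have h2 := h a i c (a i)
    have h3 := h a i b (c * a i)
    rw [Function.update_eq_self] at h1 h2
    simp only [slotComm_apply, Function.update_idem, Function.update_self, h1, h2, h3, zero_apply]
    ring
  rw [this]
  exact Submodule.zero_mem _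

/-- Multiderivations are Hochschild cocycles. -/
theorem IsMultiderivation.hochschildD_eq_zero {φ : Cochain A n} (h : IsMultiderivation φ) :
    hochschildD A n φ = 0 := by
  ext a
  -- Telescoping sequence: the i-th inner face contributes F(i+1) - F(i), while the outer faces
  -- contribute F(0) and -F(n).
  let F : Fin (n + 1) → A := fun j => (-1 : ℝ) ^ (j : ℕ) • (a j * φ (j.removeNth a))
  have h1 : ∀ i : Fin n, (-1 : ℝ) ^ (i.val + 1) • φ (i.castSucc.contractNth (· * ·) a) =
      F i.succ - F i.castSucc := by
    intro i
    rw [contractNth_castSucc_eq_update, h, update_removeNth_succ, update_removeNth_castSucc]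
    simp only [F, Fin.val_succ, Fin.val_castSucc, pow_succ]
    module
  have h2 : ∑ i : Fin n, F i.succ - ∑ i : Fin n, F i.castSucc = F (Fin.last n) - F 0 := by
    linear_combination Fin.sum_univ_castSucc F - Fin.sum_univ_succ F
  rw [hochschildD_apply, Finset.sum_congr rfl fun i _ => h1 i, Finset.sum_sub_distrib, h2]
  simp only [F, Fin.removeNth_zero, Fin.removeNth_last, Fin.val_zero, pow_zero, one_smul,
    Fin.val_last, pow_succ, zero_apply, mul_comm (a (Fin.last n))]
  module

theorem alternatization_apply_mul_right (φ : Cochain A n) (τ : Equiv.Perm (Fin n))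
    (a : Fin n → A) :
    MultilinearMap.alternatization φ a =
      ∑ σ : Equiv.Perm (Fin n), Equiv.Perm.sign (σ * τ) • φ (a ∘ σ ∘ τ) := by
  rw [MultilinearMap.alternatization_apply, ← Equiv.sum_comp (Equiv.mulRight τ)]
  rfl

/-- By commutativity the inner face is invariant under swapping entries i and i+1. Since a
transposition is odd, the antisymmetrization equals its own negative. -/
theorem alternatization_innerFace (i : Fin n) (φ : Cochain A n) :
    MultilinearMap.alternatization (innerFace i φ) = 0 := by
  ext a
  have h := alternatization_apply_mul_right (innerFace i φ)
    (Equiv.swap i.castSucc i.succ) a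
  have h' : MultilinearMap.alternatization (innerFace i φ) a =
      -MultilinearMap.alternatization (innerFace i φ) a := by
    conv_lhs => rw [h]
    rw [MultilinearMap.alternatization_apply, ← Finset.sum_neg_distrib]
    refine Finset.sum_congr rfl fun σ _ => ?_
    have hs : innerFace i φ (a ∘ σ ∘ Equiv.swap i.castSucc i.succ) = innerFace i φ (a ∘ σ) := by
      rw [innerFace_apply, innerFace_apply]
      exact congrArg φ (contractNth_comp_swap i (a ∘ σ))
    rw [hs, Equiv.Perm.sign_mul, Equiv.Perm.sign_swap (Fin.castSucc_lt_succ).ne, mul_neg, mul_one,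
      Units.neg_smul]
    rfl
  have h2 : (2 : ℝ) • MultilinearMap.alternatization (innerFace i φ) a = 0 := by
    rw [two_smul]
    exact eq_neg_iff_add_eq_zero.1 h'
  exact (smul_eq_zero_iff_right (two_ne_zero)).1 h2

theorem rightFace_comp_finRotate (φ : Cochain A n) (a : Fin (n + 1) → A) :
    rightFace φ (a ∘ finRotate (n + 1)) = leftFace φ a := by
  rw [rightFace_apply, leftFace_apply, mul_comm]
  have h : Fin.init (a ∘ finRotate (n + 1)) = Fin.tail a := by
    funext k
    simp [Fin.init, Fin.tail]
  rw [h, Function.comp_apply, finRotate_last]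

/-- The cyclic rotation of the n+1 arguments carries the right face to the left face and has sign
(-1)^n. -/
theorem alternatization_rightFace (φ : Cochain A n) :
    MultilinearMap.alternatization (rightFace φ) =
      (-1 : ℝ) ^ n • MultilinearMap.alternatization (leftFace φ) := by
  ext a
  rw [alternatization_apply_mul_right _ (finRotate (n + 1)), AlternatingMap.smul_apply,
    MultilinearMap.alternatization_apply, Finset.smul_sum]
  refine Finset.sum_congr rfl fun σ _ => ?_
  have h : rightFace φ (a ∘ σ ∘ finRotate (n + 1)) = leftFace φ (a ∘ σ) :=
    rightFace_comp_finRotate φ (a ∘ σ)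
  rw [h, Equiv.Perm.sign_mul, sign_finRotate, mul_comm, mul_smul]
  change _ = (-1 : ℝ) ^ n • (Equiv.Perm.sign σ • leftFace φ (a ∘ σ))
  simp only [Units.smul_def, ← Int.cast_smul_eq_zsmul ℝ]
  simp

/-- The antisymmetrization of a Hochschild coboundary of a commutative algebra vanishes. -/
theorem alternatization_hochschildD (φ : Cochain A n) :
    MultilinearMap.alternatization (hochschildD A n φ) = 0 := by
  have hs : ∀ (r : ℝ) (ψ : Cochain A (n + 1)), MultilinearMap.alternatization (r • ψ) =
      r • MultilinearMap.alternatization ψ := by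
    intro r ψ
    ext a
    simp only [AlternatingMap.smul_apply, MultilinearMap.alternatization_apply, Finset.smul_sum,
      MultilinearMap.domDomCongr_apply, smul_apply]
    exact Finset.sum_congr rfl fun σ _ => smul_comm _ _ _
  simp only [hochschildD, LinearMap.add_apply, LinearMap.sum_apply, LinearMap.smul_apply, map_add,
    map_sum, hs, alternatization_innerFace, alternatization_rightFace, smul_zero,
    Finset.sum_const_zero, add_zero, smul_smul, ← pow_add]
  -- Only the outer faces survive, with total coefficient 1 + (-1)^(n+1) (-1)^n = 0.
  rw [show n + 1 + n = 2 * n + 1 by ring, pow_succ, pow_mul]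
  simp

theorem alternatization_coe_alternatingMap (ψ : A [⋀^Fin n]→ₗ[ℝ] A) :
    MultilinearMap.alternatization (ψ : Cochain A n) = (n.factorial : ℝ) • ψ := by
  rw [AlternatingMap.coe_alternatization, Fintype.card_fin, Nat.cast_smul_eq_nsmul]

end Multiderivation

/-! ### Exterior powers -/

section ExteriorPower

variable {V W P : Type*} [AddCommGroup V] [Module ℝ V] [AddCommGroup W] [Module ℝ W]
  [AddCommGroup P] [Module ℝ P] {k : ℕ}

/-- The evaluation of a `k`-vector on covectors as an alternating form. -/
def insertAlternating (z : ⋀[ℝ]^k V) : Module.Dual ℝ V [⋀^Fin k]→ₗ[ℝ] ℝ :=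
  ((exteriorPower.pairingDual ℝ V k).flip z).compAlternatingMap (exteriorPower.ιMulti ℝ k)

theorem insertAlternating_apply (z : ⋀[ℝ]^k V) (α : Fin k → Module.Dual ℝ V) :
    insertAlternating z α = insertCovectors α z := rfl

theorem insertCovectors_ιMulti (α : Fin k → Module.Dual ℝ V) (v : Fin k → V) :
    insertCovectors α (exteriorPower.ιMulti ℝ k v) = Matrix.det (.of fun i j => α j (v i)) :=
  exteriorPower.pairingDual_ιMulti_ιMulti α v

theorem insertCovectors_map (f : W →ₗ[ℝ] V) (α : Fin k → Module.Dual ℝ V) (ξ : ⋀[ℝ]^k W) :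
    insertCovectors α (exteriorPower.map k f ξ) = insertCovectors (fun i => α i ∘ₗ f) ξ := by
  suffices (insertCovectors α) ∘ₗ (exteriorPower.map k f) = insertCovectors (fun i => α i ∘ₗ f) from
    LinearMap.congr_fun this ξ
  ext v
  simp [insertCovectors_ιMulti]

/-- The coordinates in the basis of Λ^k V induced by a basis of V are pairings with wedges of dual
basis covectors. -/
theorem eq_zero_of_insertCovectors [Module.Finite ℝ V] {z : ⋀[ℝ]^k V}
    (h : ∀ α : Fin k → Module.Dual ℝ V, insertCovectors α z = 0) : z = 0 := by
  let b := Module.finBasis ℝ V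
  refine (b.exteriorPower k).ext_elem fun s => ?_
  rw [exteriorPower.basis_repr_apply, map_zero, Finsupp.zero_apply]
  exact h _

/-- The `k`-vectors spanned by decomposable ones with an entry in `K`. -/
def wedgeSpan (k : ℕ) (K : Submodule ℝ V) : Submodule ℝ (⋀[ℝ]^k V) :=
  Submodule.span ℝ {z | ∃ v : Fin k → V, (∃ j, v j ∈ K) ∧ z = exteriorPower.ιMulti ℝ k v}

theorem insertCovectors_eq_zero_of_mem_wedgeSpan {K : Submodule ℝ V}
    {α : Fin k → Module.Dual ℝ V} (hα : ∀ i, ∀ v ∈ K, α i v = 0) {z : ⋀[ℝ]^k V}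
    (hz : z ∈ wedgeSpan k K) : insertCovectors α z = 0 := by
  suffices wedgeSpan k K ≤ LinearMap.ker (insertCovectors α) from this hz
  refine Submodule.span_le.2 ?_
  rintro _ ⟨v, ⟨j, hj⟩, rfl⟩
  rw [SetLike.mem_coe, LinearMap.mem_ker, insertCovectors_ιMulti]
  exact Matrix.det_eq_zero_of_row_eq_zero j fun i => hα i _ hj

theorem map_mem_wedgeSpan (f : W →ₗ[ℝ] V) {K : Submodule ℝ W} {ξ : ⋀[ℝ]^k W}
    (hξ : ξ ∈ wedgeSpan k K) : exteriorPower.map k f ξ ∈ wedgeSpan k (K.map f) := by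
  suffices wedgeSpan k K ≤ (wedgeSpan k (K.map f)).comap (exteriorPower.map k f) from this hξ
  refine Submodule.span_le.2 ?_
  rintro _ ⟨v, ⟨j, hj⟩, rfl⟩
  refine Submodule.subset_span ⟨f ∘ v, ⟨j, Submodule.mem_map_of_mem hj⟩, ?_⟩
  rw [exteriorPower.map_apply_ιMulti]

/-- Two decomposable `k`-vectors with factors congruent modulo `K` are congruent
modulo `wedgeSpan k K`. -/
theorem ιMulti_sub_mem_wedgeSpan {K : Submodule ℝ V} (v w : Fin k → V)
    (h : ∀ i, v i - w i ∈ K) :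
    exteriorPower.ιMulti ℝ k v - exteriorPower.ιMulti ℝ k w ∈ wedgeSpan k K := by
  -- The factors `w i` are exchanged for `v i` one at a time; each exchange costs a wedge with the
  -- entry `v i - w i` in `K`.
  suffices ∀ s : Finset (Fin k),
      exteriorPower.ιMulti ℝ k (s.piecewise v w) - exteriorPower.ιMulti ℝ k w ∈ wedgeSpan k K by
    simpa using this Finset.univ
  intro s
  induction s using Finset.induction_on with
  | empty => simp
  | insert i s hi ih =>
    have e : exteriorPower.ιMulti ℝ k ((insert i s).piecewise v w) -
        exteriorPower.ιMulti ℝ k (s.piecewise v w) =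
        exteriorPower.ιMulti ℝ k (Function.update (s.piecewise v w) i (v i - w i)) := by
      rw [Finset.piecewise_insert, AlternatingMap.map_update_sub]
      congr 2
      rw [eq_comm, Function.update_eq_self_iff]
      simp [hi]
    rw [← sub_add_sub_cancel _ (exteriorPower.ιMulti ℝ k (s.piecewise v w)), e]
    exact Submodule.add_mem _ (Submodule.subset_span ⟨_, ⟨i, by simpa using h i⟩, rfl⟩) ih

/-- The kernel of the map induced on `k`-vectors by a surjection is spanned by the decomposable
`k`-vectors with an entry in the kernel. -/
theorem mem_wedgeSpan_ker_of_map_eq_zero {f : W →ₗ[ℝ] P} (hf : Function.Surjective f)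
    {ξ : ⋀[ℝ]^k W} (hξ : exteriorPower.map k f ξ = 0) : ξ ∈ wedgeSpan k (LinearMap.ker f) := by
  -- For a linear section s, s ∘ f differs from the identity by elements of ker f. Thus Λ^k(s ∘ f)
  -- is the identity modulo `wedgeSpan k (LinearMap.ker f)`.
  obtain ⟨s, hs⟩ := f.exists_rightInverse_of_surjective (LinearMap.range_eq_top.2 hf)
  have key : ∀ ζ : ⋀[ℝ]^k W, ζ - exteriorPower.map k s (exteriorPower.map k f ζ) ∈
      wedgeSpan k (LinearMap.ker f) := by
    intro ζ
    have hζ : ζ ∈ Submodule.span ℝ (Set.range (exteriorPower.ιMulti ℝ k (M := W))) := by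
      rw [exteriorPower.ιMulti_span]
      trivial
    induction hζ using Submodule.span_induction with
    | mem x hx =>
      obtain ⟨v, rfl⟩ := hx
      rw [exteriorPower.map_apply_ιMulti, exteriorPower.map_apply_ιMulti]
      refine ιMulti_sub_mem_wedgeSpan _ _ fun i => ?_
      have := LinearMap.congr_fun hs (f (v i))
      simp only [LinearMap.comp_apply, LinearMap.id_apply] at this
      simp [LinearMap.mem_ker, this]
    | zero => simp
    | add x y _ _ hx hy =>
      rw [map_add, map_add, add_sub_add_comm]
      exact Submodule.add_mem _ hx hy
    | smul r x _ hx =>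
      rw [map_smul, map_smul, ← smul_sub]
      exact Submodule.smul_mem _ _ hx
  have := key ξ
  rwa [hξ, map_zero, sub_zero] at this

end ExteriorPower

/-! ### Covectors and smoothness -/

section Covectors

variable {m : ℕ} {M : Type u} [TopologicalSpace M] [ChartedSpace (EuclideanSpace ℝ (Fin m)) M]

theorem covectorAt_eq_of_comp {c : ℕ} {C : Type v} [TopologicalSpace C]
    [ChartedSpace (EuclideanSpace ℝ (Fin c)) C] {q : ℕ} {Q : Type w} [TopologicalSpace Q]
    [ChartedSpace (EuclideanSpace ℝ (Fin q)) Q] {f : C^∞⟮𝓡 m, M; ℝ⟯} {g : C^∞⟮𝓡 q, Q; ℝ⟯}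
    {i : C → M} {π : C → Q} {x : C} (hi : ContMDiffAt (𝓡 c) (𝓡 m) ∞ i x)
    (hπ : ContMDiffAt (𝓡 c) (𝓡 q) ∞ π x) (h : ∀ x, f (i x) = g (π x)) :
    covectorAt f (i x) ∘ₗ (mfderiv (𝓡 c) (𝓡 m) i x).toLinearMap =
      covectorAt g (π x) ∘ₗ (mfderiv (𝓡 c) (𝓡 q) π x).toLinearMap := by
  have hn : (∞ : WithTop ℕ∞) ≠ 0 := by simp
  have h1 := mfderiv_comp x (f.contMDiff.mdifferentiable hn (i x)) (hi.mdifferentiableAt hn)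
  have h2 := mfderiv_comp x (g.contMDiff.mdifferentiable hn (π x)) (hπ.mdifferentiableAt hn)
  have h3 : (f ∘ i : C → ℝ) = g ∘ π := funext h
  rw [h3, h2] at h1
  exact congrArg ContinuousLinearMap.toLinearMap h1.symm

variable [IsManifold (𝓡 m) ∞ M]

theorem covectorAt_eq_fderiv_comp (f : C^∞⟮𝓡 m, M; ℝ⟯) (p₀ : M) {p : M}
    (hp : p ∈ (extChartAt (𝓡 m) p₀).source) :
    covectorAt f p = (fderiv ℝ (f ∘ (extChartAt (𝓡 m) p₀).symm)
      (extChartAt (𝓡 m) p₀ p)).toLinearMap ∘ₗ (mfderiv (𝓡 m)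
        𝓘(ℝ, EuclideanSpace ℝ (Fin m)) (extChartAt (𝓡 m) p₀) p).toLinearMap := by
  set φ := extChartAt (𝓡 m) p₀
  have h1 : f =ᶠ[𝓝 p] (f ∘ φ.symm) ∘ φ := by
    filter_upwards [(isOpen_extChartAt_source p₀).mem_nhds hp] with x hx
    rw [Function.comp_apply, Function.comp_apply, φ.left_inv hx]
  have h2 : ContDiffOn ℝ ∞ (f ∘ φ.symm) φ.target :=
    (f.contMDiff.comp_contMDiffOn (contMDiffOn_extChartAt_symm p₀)).contDiffOn
  have h3 : DifferentiableAt ℝ (f ∘ φ.symm) (φ p) :=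
    (h2.contDiffAt ((isOpen_extChartAt_target p₀).mem_nhds (φ.map_source hp))).differentiableAt
      (by simp)
  have h4 := mfderiv_comp (I := 𝓡 m) (I' := 𝓘(ℝ, EuclideanSpace ℝ (Fin m))) (I'' := 𝓘(ℝ, ℝ)) p
    h3.mdifferentiableAt (mdifferentiableAt_extChartAt (by simpa [φ] using hp))
  rw [mfderiv_eq_fderiv, ← h1.mfderiv_eq] at h4
  exact congrArg ContinuousLinearMap.toLinearMap h4

/-- In a chart each df_i is a combination of coordinate covectors with smooth partial derivatives as
coefficients. Multilinearity expands the pairing into products of these with the components of X,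
which are smooth by definition. -/
theorem contMDiff_insertCovectors {k : ℕ} (X : multivectorFields m M k)
    (f : Fin k → C^∞⟮𝓡 m, M; ℝ⟯) :
    ContMDiff (𝓡 m) 𝓘(ℝ, ℝ) ∞ fun p => insertCovectors (fun i => covectorAt (f i) p) (X.1 p) := by
  intro p₀
  set φ := extChartAt (𝓡 m) p₀ with hφ
  let b := (EuclideanSpace.basisFun (Fin m) ℝ).toBasis
  have hU : φ.source ∈ 𝓝 p₀ := extChartAt_source_mem_nhds p₀
  have hF : ∀ i, ContDiffOn ℝ ∞ (f i ∘ φ.symm) φ.target := fun i =>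
    ((f i).contMDiff.comp_contMDiffOn (contMDiffOn_extChartAt_symm p₀)).contDiffOn
  have hpart : ∀ i (e : EuclideanSpace ℝ (Fin m)), ContMDiffOn (𝓡 m) 𝓘(ℝ, ℝ) ∞
      (fun p => fderiv ℝ (f i ∘ φ.symm) (φ p) e) φ.source := by
    intro i e
    have h1 : ContDiffOn ℝ ∞ (fun y => fderiv ℝ (f i ∘ φ.symm) y e) φ.target :=
      ((hF i).fderiv_of_isOpen (isOpen_extChartAt_target p₀) le_rfl).clm_apply contDiffOn_const
    exact h1.contMDiffOn.comp (contMDiffOn_extChartAt.mono (by simp [hφ]))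
      fun p hp => φ.map_source hp
  have hsum : ContMDiffOn (𝓡 m) 𝓘(ℝ, ℝ) ∞ (fun p => ∑ J : Fin k → Fin m,
      (∏ i, fderiv ℝ (f i ∘ φ.symm) (φ p) (b (J i))) *
        insertCovectors (fun i => (b.coord (J i)) ∘ₗ (mfderiv (𝓡 m)
        𝓘(ℝ, EuclideanSpace ℝ (Fin m)) (extChartAt (𝓡 m) p₀) p).toLinearMap) (X.1 p)) φ.source :=
    contMDiffOn_finsetSum fun J _ => (contMDiffOn_finsetProd fun i _ => hpart i _).mul (X.2 p₀ _)
  refine (hsum.contMDiffAt hU).congr_of_eventuallyEq ?_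
  filter_upwards [hU] with p hp
  have h : (fun i => covectorAt (f i) p) = fun i => ∑ j, fderiv ℝ (f i ∘ φ.symm) (φ p) (b j) •
      ((b.coord j) ∘ₗ (mfderiv (𝓡 m)
        𝓘(ℝ, EuclideanSpace ℝ (Fin m)) (extChartAt (𝓡 m) p₀) p).toLinearMap) := by
    funext i
    rw [covectorAt_eq_fderiv_comp (f i) p₀ hp]
    refine LinearMap.ext fun v => ?_
    set w : EuclideanSpace ℝ (Fin m) := mfderiv (𝓡 m)
      𝓘(ℝ, EuclideanSpace ℝ (Fin m)) (extChartAt (𝓡 m) p₀) p v with hw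
    have h1 := congrArg (fderiv ℝ (f i ∘ φ.symm) (φ p)) (b.sum_repr w)
    rw [map_sum] at h1
    rw [LinearMap.sum_apply]
    refine h1.symm.trans (Finset.sum_congr rfl fun j _ => ?_)
    rw [map_smul, smul_eq_mul, mul_comm]
    rfl
  rw [h, ← insertAlternating_apply]
  refine ((insertAlternating (X.1 p)).toMultilinearMap.map_sum _).trans ?_
  refine Finset.sum_congr rfl fun J _ => ?_
  exact (insertAlternating (X.1 p)).toMultilinearMap.map_smul_univ _ _

/-- Every covector is the differential of a smooth function. -/
theorem exists_covectorAt_eq [T2Space M] (p : M) (β : Module.Dual ℝ (TangentSpace (𝓡 m) p)) :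
    ∃ f : C^∞⟮𝓡 m, M; ℝ⟯, covectorAt f p = β := by
  let χ : SmoothBumpFunction (𝓡 m) p := Classical.choice inferInstance
  let l : EuclideanSpace ℝ (Fin m) →L[ℝ] ℝ :=
    LinearMap.toContinuousLinearMap (E := EuclideanSpace ℝ (Fin m)) β
  have hl : ContMDiffOn (𝓡 m) 𝓘(ℝ, ℝ) ∞ (l ∘ extChartAt (𝓡 m) p)
      (chartAt (EuclideanSpace ℝ (Fin m)) p).source :=
    l.contDiff.contMDiff.comp_contMDiffOn contMDiffOn_extChartAt
  refine ⟨⟨fun x => χ x • (l ∘ extChartAt (𝓡 m) p) x, χ.contMDiff_smul hl⟩, ?_⟩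
  have h1 : (fun x => χ x • (l ∘ extChartAt (𝓡 m) p) x) =ᶠ[𝓝 p] l ∘ extChartAt (𝓡 m) p := by
    filter_upwards [χ.eventuallyEq_one] with x hx
    rw [hx, Pi.one_apply, one_smul]
  have h2 := mfderiv_comp (I := 𝓡 m) (I' := 𝓘(ℝ, EuclideanSpace ℝ (Fin m))) (I'' := 𝓘(ℝ, ℝ)) p
    (l.contDiff.contMDiff.mdifferentiable one_ne_zero _)
    (mdifferentiableAt_extChartAt (mem_chart_source (EuclideanSpace ℝ (Fin m)) p))
  have h3 : mfderiv (𝓡 m) 𝓘(ℝ, ℝ) (fun x => χ x • (l ∘ extChartAt (𝓡 m) p) x) p = l := by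
    -- The tangent space at `p` is trivialized by the preferred chart at `p`, whose derivative there
    -- is the identity, so `l` is recovered as it stands.
    rw [h1.mfderiv_eq, h2, mfderiv_extChartAt_self, mfderiv_eq_fderiv, l.fderiv]
    rfl
  exact congrArg ContinuousLinearMap.toLinearMap h3

end Covectors

/-! ### Local sections and local retractions -/

section Local

variable {m n : ℕ} {M : Type u} [TopologicalSpace M] [ChartedSpace (EuclideanSpace ℝ (Fin m)) M]
  {N : Type v} [TopologicalSpace N] [ChartedSpace (EuclideanSpace ℝ (Fin n)) N]

/-- In adapted charts f is a linear projection. The section freezes the complementary coordinate at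
its value at x, so that it passes through x. -/
theorem Manifold.IsSubmersionAt.exists_localSection {f : M → N} {x : M}
    (h : Manifold.IsSubmersionAt (𝓡 m) (𝓡 n) ∞ f x) :
    ∃ σ : N → M, ContMDiffAt (𝓡 n) (𝓡 m) ∞ σ (f x) ∧ σ (f x) = x ∧
      ∀ᶠ y in 𝓝 (f x), f (σ y) = y := by
  obtain ⟨F, _, _, h⟩ := h
  set φ := h.domChart
  set ψ := h.codChart
  have hw : ∀ u ∈ φ.target, ψ (f (φ.symm u)) = (h.equiv u).1 := fun u hu => by
    have := h.writtenInCharts (show u ∈ (φ.extend (𝓡 m)).target by simpa using hu)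
    simpa using this
  have hx : x ∈ φ.source := h.mem_domChart_source
  have hy : f x ∈ ψ.source := h.mem_codChart_source
  let τ : N → EuclideanSpace ℝ (Fin m) := fun y => h.equiv.symm (ψ y, (h.equiv (φ x)).2)
  have hτx : τ (f x) = φ x := by
    have := hw (φ x) (φ.map_source hx)
    rw [φ.left_inv hx] at this
    simp [τ, this]
  have hτ : ContMDiffAt (𝓡 n) (𝓡 m) ∞ τ (f x) := by
    have h1 : ContDiff ℝ ∞ fun u : EuclideanSpace ℝ (Fin n) =>
        h.equiv.symm (u, (h.equiv (φ x)).2) :=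
      h.equiv.symm.contDiff.comp (contDiff_id.prodMk contDiff_const)
    exact h1.contMDiff.contMDiffAt.comp (f x) (contMDiffAt_of_mem_maximalAtlas
      h.codChart_mem_maximalAtlas hy)
  have hφ : ContMDiffAt (𝓡 m) (𝓡 m) ∞ φ.symm (τ (f x)) := by
    rw [hτx]
    exact contMDiffAt_symm_of_mem_maximalAtlas h.domChart_mem_maximalAtlas (φ.map_source hx)
  refine ⟨φ.symm ∘ τ, hφ.comp (f x) hτ, ?_, ?_⟩
  · simp [hτx, φ.left_inv hx]
  · have h1 : ∀ᶠ y in 𝓝 (f x), τ y ∈ φ.target := by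
      refine hτ.continuousAt.eventually_mem (φ.open_target.mem_nhds ?_)
      rw [hτx]
      exact φ.map_source hx
    filter_upwards [h1, ψ.open_source.mem_nhds hy] with y hy1 hy2
    have hs : φ.symm (τ y) ∈ φ.source := φ.map_target hy1
    refine ψ.injOn (h.source_subset_preimage_source hs) hy2 ?_
    rw [hw _ hy1]
    simp [τ]

/-- In adapted charts f is u ↦ (u, 0), and the retraction drops the second coordinate. -/
theorem Manifold.IsImmersionAt.exists_localRetraction {f : M → N} {x : M}
    (h : Manifold.IsImmersionAt (𝓡 m) (𝓡 n) ∞ f x) :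
    ∃ (ρ : N → M) (U : Set N), U ∈ 𝓝 (f x) ∧ ContMDiffOn (𝓡 n) (𝓡 m) ∞ ρ U ∧
      ∀ᶠ z in 𝓝 x, ρ (f z) = z := by
  obtain ⟨F, _, _, h⟩ := h
  set φ := h.domChart
  set ψ := h.codChart
  have hw : ∀ u ∈ φ.target, ψ (f (φ.symm u)) = h.equiv (u, 0) := fun u hu => by
    have := h.writtenInCharts (show u ∈ (φ.extend (𝓡 m)).target by simpa using hu)
    simpa using this
  have hx : x ∈ φ.source := h.mem_domChart_source
  have hy : f x ∈ ψ.source := h.mem_codChart_source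
  let τ : N → EuclideanSpace ℝ (Fin m) := fun y => (h.equiv.symm (ψ y)).1
  have hτf : ∀ z ∈ φ.source, τ (f z) = φ z := fun z hz => by
    have := hw (φ z) (φ.map_source hz)
    rw [φ.left_inv hz] at this
    simp [τ, this]
  have hτ : ContMDiffOn (𝓡 n) (𝓡 m) ∞ τ ψ.source := by
    have h1 : ContDiff ℝ ∞ fun u : EuclideanSpace ℝ (Fin n) => (h.equiv.symm u).1 :=
      contDiff_fst.comp h.equiv.symm.contDiff
    exact h1.contMDiff.comp_contMDiffOn (contMDiffOn_of_mem_maximalAtlas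
      h.codChart_mem_maximalAtlas)
  refine ⟨φ.symm ∘ τ, ψ.source ∩ τ ⁻¹' φ.target, ?_, ?_, ?_⟩
  · refine (hτ.continuousOn.isOpen_inter_preimage ψ.open_source φ.open_target).mem_nhds ⟨hy, ?_⟩
    rw [Set.mem_preimage, hτf x hx]
    exact φ.map_source hx
  · exact (contMDiffOn_symm_of_mem_maximalAtlas h.domChart_mem_maximalAtlas).comp
      (hτ.mono Set.inter_subset_left) fun y hy => hy.2
  · filter_upwards [φ.open_source.mem_nhds hx] with z hz
    rw [Function.comp_apply, hτf z hz, φ.left_inv hz]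

/-- A smooth function on a closed embedded submanifold extends to the ambient manifold. -/
theorem Manifold.IsSmoothEmbedding.exists_extension [IsManifold (𝓡 n) ∞ N] [T2Space N]
    [SecondCountableTopology N] {i : M → N} (hi : Manifold.IsSmoothEmbedding (𝓡 m) (𝓡 n) ∞ i)
    (hc : IsClosed (Set.range i)) {g : M → ℝ} (hg : ContMDiff (𝓡 m) 𝓘(ℝ, ℝ) ∞ g) :
    ∃ f : C^∞⟮𝓡 n, N; ℝ⟯, ∀ x, f (i x) = g x := by
  have : LocallyCompactSpace N :=
    ChartedSpace.locallyCompactSpace (EuclideanSpace ℝ (Fin n)) N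
  -- The admissible values at `p`: all of ℝ off the submanifold, the prescribed value on it. These
  -- sets are convex, so local extensions glue by a partition of unity.
  let t : N → Set ℝ := fun p => {r | ∀ x, i x = p → r = g x}
  have ht : ∀ p, Convex ℝ (t p) := by
    intro p r hr s hs a b _ _ hab x hx
    rw [hr x hx, hs x hx, ← add_smul, hab, one_smul]
  have hloc : ∀ p : N, ∃ U ∈ 𝓝 p, ∃ h : N → ℝ,
      ContMDiffOn (𝓡 n) 𝓘(ℝ, ℝ) ∞ h U ∧ ∀ y ∈ U, h y ∈ t y := by
    intro p
    by_cases hp : p ∈ Set.range i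
    · obtain ⟨x, rfl⟩ := hp
      obtain ⟨ρ, U, hU, hρ, h⟩ := (hi.isImmersion.isImmersionAt x).exists_localRetraction
      -- The embedding topology turns "near x in the submanifold" into "near i x in the ambient
      -- manifold"; for a mere immersion other sheets could pass through the neighbourhood.
      rw [hi.isEmbedding.nhds_eq_comap, Filter.eventually_comap] at h
      refine ⟨U ∩ {y | ∀ z, i z = y → ρ (i z) = z}, Filter.inter_mem hU h, g ∘ ρ,
        hg.comp_contMDiffOn (hρ.mono Set.inter_subset_left), fun y hy z hz => ?_⟩
      rw [Function.comp_apply, ← hz, hy.2 z hz]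
    · exact ⟨(Set.range i)ᶜ, hc.isOpen_compl.mem_nhds hp, fun _ => 0, contMDiffOn_const,
        fun y hy x hx => absurd ⟨x, hx⟩ hy⟩
  obtain ⟨f, hf⟩ := exists_contMDiffMap_forall_mem_convex_of_local (𝓡 n) (n := ⊤) ht hloc
  exact ⟨f, fun x => hf (i x) x rfl⟩

/-- Differentiating f ∘ σ = id for a local section σ through x gives a right inverse of the
derivative. -/
theorem Manifold.IsSubmersionAt.surjective_mfderiv {f : M → N} {x : M}
    (h : Manifold.IsSubmersionAt (𝓡 m) (𝓡 n) ∞ f x) (hf : ContMDiffAt (𝓡 m) (𝓡 n) ∞ f x) :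
    Function.Surjective (mfderiv (𝓡 m) (𝓡 n) f x) := by
  obtain ⟨σ, hσ, hσx, hs⟩ := h.exists_localSection
  have hn : (∞ : WithTop ℕ∞) ≠ 0 := by simp
  have h1 := mfderiv_comp_of_eq (x := f x) (y := x) (hf.mdifferentiableAt hn)
    (hσ.mdifferentiableAt hn) hσx
  have h2 : (f ∘ σ) =ᶠ[𝓝 (f x)] id := hs
  rw [h2.mfderiv_eq, mfderiv_id] at h1
  have key : Function.Surjective (mfderiv (𝓡 m) (𝓡 n) f (σ (f x))) := fun v =>
    ⟨mfderiv (𝓡 n) (𝓡 m) σ (f x) v, (congrArg (fun L : TangentSpace (𝓡 n) (f x) →L[ℝ]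
      TangentSpace (𝓡 n) (f x) => L v) h1).symm⟩
  rwa [hσx] at key

end Local

/-! ### The Hochschild–Kostant–Rosenberg map -/

section HKR

variable {m : ℕ} {M : Type u} [TopologicalSpace M] [ChartedSpace (EuclideanSpace ℝ (Fin m)) M]

theorem hasMFDerivAt_of_smooth (f : C^∞⟮𝓡 m, M; ℝ⟯) (p : M) :
    HasMFDerivAt (𝓡 m) 𝓘(ℝ, ℝ) f p (mfderiv (𝓡 m) 𝓘(ℝ, ℝ) f p) :=
  (f.contMDiff.mdifferentiable (by simp) p).hasMFDerivAt

/-- The differential at a point as a linear map on smooth functions. -/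
def covectorLinear (p : M) : C^∞⟮𝓡 m, M; ℝ⟯ →ₗ[ℝ] Module.Dual ℝ (TangentSpace (𝓡 m) p) where
  toFun f := covectorAt f p
  map_add' f g := congrArg ContinuousLinearMap.toLinearMap
    ((hasMFDerivAt_of_smooth f p).add (hasMFDerivAt_of_smooth g p)).mfderiv
  map_smul' r f := congrArg ContinuousLinearMap.toLinearMap
    ((hasMFDerivAt_of_smooth f p).const_smul r).mfderiv

theorem covectorLinear_apply (p : M) (f : C^∞⟮𝓡 m, M; ℝ⟯) :
    covectorLinear p f = covectorAt f p := rfl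

theorem covectorLinear_mul (p : M) (f g : C^∞⟮𝓡 m, M; ℝ⟯) :
    covectorLinear p (f * g) = f p • covectorLinear p g + g p • covectorLinear p f :=
  congrArg ContinuousLinearMap.toLinearMap
    ((hasMFDerivAt_of_smooth f p).mul (hasMFDerivAt_of_smooth g p)).mfderiv

variable [IsManifold (𝓡 m) ∞ M] {k : ℕ}

/-- The alternating multiderivation `(f₁, …, f_k) ↦ (1 / k!) ins_{df₁, …, df_k} X`. -/
def multivectorCochain (X : multivectorFields m M k) :
    C^∞⟮𝓡 m, M; ℝ⟯ [⋀^Fin k]→ₗ[ℝ] C^∞⟮𝓡 m, M; ℝ⟯ where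
  toFun f := ⟨fun p => (1 / (k.factorial : ℝ)) *
      insertCovectors (fun i => covectorAt (f i) p) (X.1 p),
    contMDiff_const.mul (contMDiff_insertCovectors X f)⟩
  map_update_add' f i x y := by
    ext p
    have := ((insertAlternating (X.1 p)).compLinearMap (covectorLinear p)).map_update_add f i x y
    exact (congrArg _ this).trans (mul_add _ _ _)
  map_update_smul' f i r x := by
    ext p
    have := ((insertAlternating (X.1 p)).compLinearMap (covectorLinear p)).map_update_smul f i r x
    exact (congrArg _ this).trans (mul_left_comm _ _ _)
  map_eq_zero_of_eq' f i j h hij := by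
    ext p
    have := ((insertAlternating (X.1 p)).compLinearMap (covectorLinear p)).map_eq_zero_of_eq f h hij
    exact (congrArg _ this).trans (mul_zero _)

theorem multivectorCochain_apply (X : multivectorFields m M k) (f : Fin k → C^∞⟮𝓡 m, M; ℝ⟯)
    (p : M) : multivectorCochain X f p = (1 / (k.factorial : ℝ)) *
      insertCovectors (fun i => covectorAt (f i) p) (X.1 p) := rfl

theorem multivectorCochain_add (X Y : multivectorFields m M k) (f : Fin k → C^∞⟮𝓡 m, M; ℝ⟯) :
    multivectorCochain (X + Y) f = multivectorCochain X f + multivectorCochain Y f := by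
  ext p
  exact (congrArg _ (map_add (insertCovectors _) (X.1 p) (Y.1 p))).trans (mul_add _ _ _)

theorem multivectorCochain_smul (r : ℝ) (X : multivectorFields m M k)
    (f : Fin k → C^∞⟮𝓡 m, M; ℝ⟯) : multivectorCochain (r • X) f = r • multivectorCochain X f := by
  ext p
  exact (congrArg _ (map_smul (insertCovectors _) r (X.1 p))).trans (mul_left_comm _ _ _)

theorem isMultiderivation_multivectorCochain (X : multivectorFields m M k) :
    IsMultiderivation (multivectorCochain X : Cochain C^∞⟮𝓡 m, M; ℝ⟯ k) := by
  intro f i x y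
  ext p
  let ψ := insertAlternating (X.1 p)
  have hu : ∀ z, (fun j => covectorAt (Function.update f i z j) p) =
      Function.update (fun j => covectorAt (f j) p) i (covectorLinear p z) := by
    intro z
    funext j
    by_cases h : j = i
    · subst h
      simp [covectorLinear_apply]
    · simp [h]
  have hv : ∀ z, multivectorCochain X (Function.update f i z) p = (1 / (k.factorial : ℝ)) *
      ψ (Function.update (fun j => covectorAt (f j) p) i (covectorLinear p z)) := by
    intro z
    exact congrArg (fun α => (1 / (k.factorial : ℝ)) * ψ α) (hu z)
  change multivectorCochain X (Function.update f i (x * y)) p =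
    x p * multivectorCochain X (Function.update f i y) p +
      y p * multivectorCochain X (Function.update f i x) p
  rw [hv, hv, hv, covectorLinear_mul, ψ.map_update_add, ψ.map_update_smul, ψ.map_update_smul,
    smul_eq_mul, smul_eq_mul]
  ring

/-- At each point the differentials of functions realize all covectors, and these detect a k-vector.
-/
theorem eq_zero_of_multivectorCochain [T2Space M] {X : multivectorFields m M k}
    (h : ∀ f, multivectorCochain X f = 0) : X = 0 := by
  refine Subtype.ext (funext fun p => ?_)
  have : Module.Finite ℝ (TangentSpace (𝓡 m) p) :=
    inferInstanceAs (Module.Finite ℝ (EuclideanSpace ℝ (Fin m)))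
  refine eq_zero_of_insertCovectors (V := TangentSpace (𝓡 m) p) fun α => ?_
  choose f hf using fun i => exists_covectorAt_eq p (α i)
  have h1 := congrArg (fun g : C^∞⟮𝓡 m, M; ℝ⟯ => g p) (h f)
  simp only [multivectorCochain_apply, hf] at h1
  exact (mul_eq_zero.1 h1).resolve_left (by positivity)

end HKR

/-! ### Descent to the leaf space and the constraint HKR map -/

namespace ConstraintManifold

variable {m c q : ℕ} {M : Type u} {C : Type v} {Q : Type w}
  [TopologicalSpace M] [ChartedSpace (EuclideanSpace ℝ (Fin m)) M]
  [TopologicalSpace C] [ChartedSpace (EuclideanSpace ℝ (Fin c)) C]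
  [TopologicalSpace Q] [ChartedSpace (EuclideanSpace ℝ (Fin q)) Q]
  (𝓜 : ConstraintManifold m c q M C Q) {k : ℕ}

theorem surjective_proj : Function.Surjective 𝓜.proj := fun y =>
  (𝓜.isConnected_fibre y).nonempty

theorem surjective_projT (x : C) : Function.Surjective (𝓜.projT x) :=
  (𝓜.isSubmersion_proj.isSubmersionAt x).surjective_mfderiv
    (𝓜.isSubmersion_proj.contMDiff x)

/-- Functions in the `N`-component descend to smooth functions on the leaf space. -/
theorem exists_descent {f : C^∞⟮𝓡 m, M; ℝ⟯} (hf : f ∈ 𝓜.functionsN) :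
    ∃ g : C^∞⟮𝓡 q, Q; ℝ⟯, ∀ x, f (𝓜.incl x) = g (𝓜.proj x) := by
  choose s hs using 𝓜.surjective_proj
  have hfs : ∀ x, f (𝓜.incl x) = f (𝓜.incl (s (𝓜.proj x))) := fun x =>
    hf _ _ (hs (𝓜.proj x)).symm
  refine ⟨⟨fun y => f (𝓜.incl (s y)), fun y => ?_⟩, hfs⟩
  obtain ⟨x, rfl⟩ := 𝓜.surjective_proj y
  -- The section `s` need not be continuous, but constancy along fibres lets a smooth local section
  -- replace it near each point.
  obtain ⟨σ, hσ, -, h⟩ := (𝓜.isSubmersion_proj.isSubmersionAt x).exists_localSection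
  have h1 : ContMDiffAt (𝓡 q) 𝓘(ℝ, ℝ) ∞ (fun y => f (𝓜.incl (σ y))) (𝓜.proj x) :=
    (f.contMDiff.comp 𝓜.isSmoothEmbedding_incl.contMDiff).contMDiffAt.comp (𝓜.proj x) hσ
  refine h1.congr_of_eventuallyEq ?_
  filter_upwards [h] with y hy
  rw [hfs (σ y), hy]

/-- Pull g back to C and extend from the closed submanifold to M; the extension is constant along
leaves because its restriction is a pull-back. -/
theorem exists_lift [IsManifold (𝓡 m) ∞ M] [T2Space M] [SecondCountableTopology M]
    (g : C^∞⟮𝓡 q, Q; ℝ⟯) : ∃ f : 𝓜.functionsN, ∀ x, f.1 (𝓜.incl x) = g (𝓜.proj x) := by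
  obtain ⟨f, hf⟩ := 𝓜.isSmoothEmbedding_incl.exists_extension 𝓜.isClosed_range_incl
    (g.contMDiff.comp 𝓜.isSubmersion_proj.contMDiff)
  exact ⟨⟨f, fun x y h => by rw [hf, hf, Function.comp_apply, h, Function.comp_apply]⟩, hf⟩

theorem covectorAt_comp_inclT {f : C^∞⟮𝓡 m, M; ℝ⟯} {g : C^∞⟮𝓡 q, Q; ℝ⟯}
    (h : ∀ x, f (𝓜.incl x) = g (𝓜.proj x)) (x : C) :
    covectorAt f (𝓜.incl x) ∘ₗ 𝓜.inclT x = covectorAt g (𝓜.proj x) ∘ₗ 𝓜.projT x :=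
  covectorAt_eq_of_comp (𝓜.isSmoothEmbedding_incl.contMDiff x)
    (𝓜.isSubmersion_proj.contMDiff x) h

/-- On T_xC each df_i factors through `projT`, whose kernel is D. So the part of z in D ∧ Λ^{k-1} TM
pairs to zero, and the remaining part can be paired on Q by naturality. -/
theorem insertCovectors_of_reducesTo {f : Fin k → C^∞⟮𝓡 m, M; ℝ⟯} {g : Fin k → C^∞⟮𝓡 q, Q; ℝ⟯}
    (h : ∀ i x, f i (𝓜.incl x) = g i (𝓜.proj x)) {x : C}
    {z : ⋀[ℝ]^k (TangentSpace (𝓡 m) (𝓜.incl x))} {y : ⋀[ℝ]^k (TangentSpace (𝓡 q) (𝓜.proj x))}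
    (hz : ReducesTo (𝓜.wedgeD k x) (𝓜.inclT x) (𝓜.projT x) z y) :
    insertCovectors (fun i => covectorAt (f i) (𝓜.incl x)) z =
      insertCovectors (fun i => covectorAt (g i) (𝓜.proj x)) y := by
  obtain ⟨ξ, hξ, rfl⟩ := hz
  have h0 : insertCovectors (fun i => covectorAt (f i) (𝓜.incl x))
      (z - exteriorPower.map k (𝓜.inclT x) ξ) = 0 := by
    refine insertCovectors_eq_zero_of_mem_wedgeSpan (K := (𝓜.D x).map (𝓜.inclT x)) ?_ hξ
    rintro i _ ⟨v, hv, rfl⟩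
    rw [SetLike.mem_coe, 𝓜.D_eq, LinearMap.mem_ker] at hv
    refine (LinearMap.congr_fun (𝓜.covectorAt_comp_inclT (h i) x) v).trans ?_
    exact (congrArg _ hv).trans (map_zero (covectorAt (g i) (𝓜.proj x)))
  rw [map_sub, sub_eq_zero] at h0
  rw [h0, insertCovectors_map, insertCovectors_map]
  congr 2
  funext i
  exact 𝓜.covectorAt_comp_inclT (h i) x

variable [IsManifold (𝓡 m) ∞ M]

theorem multivectorCochain_mem_functionsN (X : 𝓜.multivectorsN k) (f : Fin k → 𝓜.functionsN) :
    multivectorCochain X.1 (fun i => (f i).1) ∈ 𝓜.functionsN := by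
  obtain ⟨Y, hY⟩ := X.2
  choose g hg using fun i => 𝓜.exists_descent (f i).2
  intro x y hxy
  rw [multivectorCochain_apply, multivectorCochain_apply,
    𝓜.insertCovectors_of_reducesTo hg (hY x), 𝓜.insertCovectors_of_reducesTo hg (hY y), hxy]

/-- A function vanishing on C descends to zero on Q, so one covector in the pairing on Q is zero. -/
theorem multivectorCochain_eq_zero (X : 𝓜.multivectorsN k) (f : Fin k → 𝓜.functionsN)
    {i : Fin k} (hi : ∀ x, (f i).1 (𝓜.incl x) = 0) (x : C) :
    multivectorCochain X.1 (fun i => (f i).1) (𝓜.incl x) = 0 := by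
  obtain ⟨Y, hY⟩ := X.2
  choose g hg using fun i => 𝓜.exists_descent (f i).2
  have hgi : g i = 0 := by
    ext y
    obtain ⟨x, rfl⟩ := 𝓜.surjective_proj y
    exact (hg i x).symm.trans (hi x)
  rw [multivectorCochain_apply, 𝓜.insertCovectors_of_reducesTo hg (hY x),
    ← insertAlternating_apply, (insertAlternating _).map_coord_zero i, mul_zero]
  rw [hgi]
  exact map_zero (covectorLinear (𝓜.proj x))

theorem multivectorCochain_eq_zero_of_mem_zero {X : multivectorFields m M k}
    (hX : X ∈ 𝓜.multivectorsZero k) (f : Fin k → 𝓜.functionsN) (x : C) :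
    multivectorCochain X (fun i => (f i).1) (𝓜.incl x) = 0 := by
  choose g hg using fun i => 𝓜.exists_descent (f i).2
  rw [multivectorCochain_apply,
    𝓜.insertCovectors_of_reducesTo hg (ReducesTo.of_mem (hX x)), map_zero, mul_zero]

/-- The restriction of the multiderivation of a constraint multivector field to `A_N`. -/
def multivectorCochainN (X : 𝓜.multivectorsN k) : 𝓜.functionsN [⋀^Fin k]→ₗ[ℝ] 𝓜.functionsN where
  toFun f := ⟨multivectorCochain X.1 (fun i => (f i).1), 𝓜.multivectorCochain_mem_functionsN X f⟩
  map_update_add' f i x y := Subtype.ext <|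
    ((multivectorCochain X.1).compLinearMap 𝓜.functionsN.val.toLinearMap).map_update_add f i x y
  map_update_smul' f i r x := Subtype.ext <|
    ((multivectorCochain X.1).compLinearMap 𝓜.functionsN.val.toLinearMap).map_update_smul f i r x
  map_eq_zero_of_eq' _ _ _ h hij := Subtype.ext <|
    (multivectorCochain X.1).map_eq_zero_of_eq _ (congrArg Subtype.val h) hij

theorem isMultiderivation_multivectorCochainN (X : 𝓜.multivectorsN k) :
    IsMultiderivation (𝓜.multivectorCochainN X : Cochain 𝓜.functionsN k) := by
  intro f i x y
  have hu : ∀ z : 𝓜.functionsN, (fun j => (Function.update f i z j).1) =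
      Function.update (fun j => (f j).1) i z.1 := by
    intro z
    funext j
    by_cases h : j = i
    · subst h
      simp
    · simp [h]
  have hv : ∀ z : 𝓜.functionsN, (𝓜.multivectorCochainN X (Function.update f i z)).1 =
      multivectorCochain X.1 (Function.update (fun j => (f j).1) i z.1) :=
    fun z => congrArg (multivectorCochain X.1) (hu z)
  have h := isMultiderivation_multivectorCochain X.1 (fun j => (f j).1) i x.1 y.1
  simp only [AlternatingMap.coe_multilinearMap] at h ⊢
  rw [← hv x, ← hv y] at h
  exact Subtype.ext ((hv (x * y)).trans h)

/-- A constraint multivector field whose multiderivation takes values in `A_0` on `A_N` lies in the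
`0`-component. -/
theorem mem_multivectorsZero [T2Space M] [SecondCountableTopology M] [IsManifold (𝓡 q) ∞ Q]
    [T2Space Q] (X : 𝓜.multivectorsN k)
    (h : ∀ (f : Fin k → 𝓜.functionsN) (x : C),
      multivectorCochain X.1 (fun i => (f i).1) (𝓜.incl x) = 0) :
    X.1 ∈ 𝓜.multivectorsZero k := by
  obtain ⟨Y, hY⟩ := X.2
  intro x
  -- Arbitrary covectors at the leaf are differentials of functions on Q. Lifted to A_N, these bring
  -- the hypothesis to bear on every pairing with `Y`.
  have hY0 : Y.1 (𝓜.proj x) = 0 := by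
    have : Module.Finite ℝ (TangentSpace (𝓡 q) (𝓜.proj x)) :=
      inferInstanceAs (Module.Finite ℝ (EuclideanSpace ℝ (Fin q)))
    refine eq_zero_of_insertCovectors (V := TangentSpace (𝓡 q) (𝓜.proj x)) fun α => ?_
    choose g hg using fun i => exists_covectorAt_eq (𝓜.proj x) (α i)
    choose f hf using fun i => 𝓜.exists_lift (g i)
    have h1 := h f x
    rw [multivectorCochain_apply, 𝓜.insertCovectors_of_reducesTo hf (hY x)] at h1
    simp only [hg] at h1
    exact (mul_eq_zero.1 h1).resolve_left (by positivity)
  obtain ⟨ξ, hξ, hξY⟩ := hY x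
  rw [hY0] at hξY
  -- Since `ξ` maps to zero on Q, it is a sum of wedges with a factor in D. Hence both `ξ` and the
  -- remainder of X at x lie in `wedgeD`.
  have h2 := map_mem_wedgeSpan (𝓜.inclT x)
    (mem_wedgeSpan_ker_of_map_eq_zero (𝓜.surjective_projT x) hξY)
  have hD : LinearMap.ker (𝓜.projT x) = 𝓜.D x := (𝓜.D_eq x).symm
  rw [hD] at h2
  have h3 := (𝓜.wedgeD k x).add_mem hξ h2
  rwa [sub_add_cancel] at h3

/-- The Hochschild–Kostant–Rosenberg map from constraint multivector fields to differential
constraint Hochschild cochains. -/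
def hkr (k : ℕ) : 𝓜.multivectors k ⟶ 𝓜.functions.diffCochains k where
  T :=
    { toFun := fun X => ⟨(multivectorCochain X : Cochain C^∞⟮𝓡 m, M; ℝ⟯ k),
        (isMultiderivation_multivectorCochain X).mem_multiDiff⟩
      map_add' := fun X Y => Subtype.ext (MultilinearMap.ext (multivectorCochain_add X Y))
      map_smul' := fun r X => Subtype.ext (MultilinearMap.ext (multivectorCochain_smul r X)) }
  N :=
    { toFun := fun X => ⟨((multivectorCochain X.1 : Cochain C^∞⟮𝓡 m, M; ℝ⟯ k),
        (𝓜.multivectorCochainN X : Cochain 𝓜.functionsN k)),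
        ⟨fun _ => rfl, fun f ⟨_, hi⟩ x => 𝓜.multivectorCochain_eq_zero X f hi x⟩,
        (isMultiderivation_multivectorCochain X.1).mem_multiDiff,
        (𝓜.isMultiderivation_multivectorCochainN X).mem_multiDiff⟩
      map_add' := fun X Y => Subtype.ext (Prod.ext
        (MultilinearMap.ext (multivectorCochain_add X.1 Y.1))
        (MultilinearMap.ext fun _ => Subtype.ext (multivectorCochain_add X.1 Y.1 _)))
      map_smul' := fun r X => Subtype.ext (Prod.ext
        (MultilinearMap.ext (multivectorCochain_smul r X.1))
        (MultilinearMap.ext fun _ => Subtype.ext (multivectorCochain_smul r X.1 _))) }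
  comm _ := rfl
  map_zero _ hX f x := 𝓜.multivectorCochain_eq_zero_of_mem_zero hX f x

/-- The Hochschild–Kostant–Rosenberg map as a morphism of complexes. -/
def hkrHom : ConComplex.Hom (ConComplex.ofGraded 𝓜.multivectors) 𝓜.functions.diffHochschild where
  f := 𝓜.hkr
  comm k := by
    have h : 𝓜.hkr k ≫ 𝓜.functions.diffHochschild.d k = 0 := by
      refine ConMod.hom_ext (fun X => Subtype.ext ?_) (fun X => Subtype.ext (Prod.ext ?_ ?_))
      · exact (isMultiderivation_multivectorCochain X).hochschildD_eq_zero
      · exact (isMultiderivation_multivectorCochain X.1).hochschildD_eq_zero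
      · exact (𝓜.isMultiderivation_multivectorCochainN X).hochschildD_eq_zero
    exact h.trans Limits.zero_comp.symm

end ConstraintManifold

/-! ### Antisymmetrization of constraint coboundaries -/

namespace ConAlg

variable (A : ConAlg.{u})

theorem alternatization_of_mem_boundariesT {n : ℕ} (φ : (A.diffCochains n).T)
    (h : φ ∈ A.diffHochschild.boundariesT n) : MultilinearMap.alternatization φ.1 = 0 := by
  cases n with
  | zero =>
    have h0 : φ = 0 := h
    rw [h0]
    exact map_zero _
  | succ n =>
    obtain ⟨ψ, rfl⟩ := h
    exact alternatization_hochschildD ψ.1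

theorem alternatization_of_mem_boundariesN {n : ℕ} (φ : (A.diffCochains n).N)
    (h : φ ∈ A.diffHochschild.boundariesN n) : MultilinearMap.alternatization φ.1.2 = 0 := by
  cases n with
  | zero =>
    have h0 : φ = 0 := h
    rw [h0]
    exact map_zero _
  | succ n =>
    obtain ⟨ψ, rfl⟩ := h
    exact alternatization_hochschildD ψ.1.2

end ConAlg

/-! ### Injectivity on cohomology and reflection of the 0-component -/

namespace ConstraintManifold

variable {m c q : ℕ} {M : Type u} {C : Type v} {Q : Type w}
  [TopologicalSpace M] [ChartedSpace (EuclideanSpace ℝ (Fin m)) M] [IsManifold (𝓡 m) ∞ M]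
  [T2Space M]
  [TopologicalSpace C] [ChartedSpace (EuclideanSpace ℝ (Fin c)) C]
  [TopologicalSpace Q] [ChartedSpace (EuclideanSpace ℝ (Fin q)) Q]
  (𝓜 : ConstraintManifold m c q M C Q)

theorem injective_induced_T (k : ℕ) : Function.Injective (𝓜.hkrHom.induced k).T := by
  refine (injective_iff_map_eq_zero _).2 fun X hX => ?_
  have h1 := (Submodule.Quotient.mk_eq_zero _).1 hX
  have h2 := 𝓜.functions.alternatization_of_mem_boundariesT _ h1
  have h3 := (alternatization_coe_alternatingMap (multivectorCochain X)).symm.trans h2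
  refine eq_zero_of_multivectorCochain fun f => ?_
  have h4 := (smul_eq_zero.1 h3).resolve_left (by positivity)
  rw [h4]
  rfl

/-- Multivector fields in the N-component embed into the T-component, so the commuting square with ι
reduces this to injectivity on T. Injectivity of ι on cohomology is not needed. -/
theorem injective_induced_N (k : ℕ) : Function.Injective (𝓜.hkrHom.induced k).N := by
  intro X Y h
  refine Subtype.ext (𝓜.injective_induced_T k ?_)
  have h1 := congrArg (𝓜.functions.diffHochschild.cohomology k).ι h
  exact ((𝓜.hkrHom.induced k).comm X).symm.trans (h1.trans ((𝓜.hkrHom.induced k).comm Y))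

/-- A representative ψ in the 0-component differs from 𝒰(X) by a coboundary, so Alt(ψ_N) = k!
𝒰(X)_N. The left side is a signed sum of values of ψ_N, hence A_0-valued, and k! is invertible. -/
theorem mem_zero_of_induced_N [SecondCountableTopology M] [IsManifold (𝓡 q) ∞ Q] [T2Space Q]
    (k : ℕ) (X : (𝓜.multivectors k).N)
    (hX : (𝓜.hkrHom.induced k).N X ∈ (𝓜.functions.diffHochschild.cohomology k).zero) :
    X ∈ (𝓜.multivectors k).zero := by
  obtain ⟨ψ, hψ0, hψ⟩ := hX
  have h1 := (Submodule.Quotient.eq _).1 hψ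
  have h2 := 𝓜.functions.alternatization_of_mem_boundariesN _ h1
  refine 𝓜.mem_multivectorsZero X fun f x => ?_
  have h3 : MultilinearMap.alternatization (ψ.1.1.2 : Cochain 𝓜.functionsN k) =
      (k.factorial : ℝ) • 𝓜.multivectorCochainN X := by
    rw [← alternatization_coe_alternatingMap]
    exact sub_eq_zero.1 ((map_sub _ _ _).symm.trans h2)
  have h4 : (MultilinearMap.alternatization (ψ.1.1.2 : Cochain 𝓜.functionsN k) f) ∈
      𝓜.functions.zero := by
    rw [MultilinearMap.alternatization_apply]
    exact sum_mem fun σ _ => Submodule.smul_of_tower_mem _ _ (hψ0 _)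
  rw [h3] at h4
  exact (mul_eq_zero.1 (h4 x)).resolve_left (by positivity)

end ConstraintManifold

end

theorem mainTheorem6 {m c q : ℕ} {M : Type u} {C : Type v} {Q : Type w}
    [TopologicalSpace M] [ChartedSpace (EuclideanSpace ℝ (Fin m)) M] [IsManifold (𝓡 m) ∞ M]
    [T2Space M] [SecondCountableTopology M]
    [TopologicalSpace C] [ChartedSpace (EuclideanSpace ℝ (Fin c)) C] [IsManifold (𝓡 c) ∞ C]
    [T2Space C] [SecondCountableTopology C]
    [TopologicalSpace Q] [ChartedSpace (EuclideanSpace ℝ (Fin q)) Q] [IsManifold (𝓡 q) ∞ Q]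
    [T2Space Q] [SecondCountableTopology Q]
    (𝓜 : ConstraintManifold m c q M C Q) :
    ∃ U : ConComplex.Hom (ConComplex.ofGraded 𝓜.multivectors) 𝓜.functions.diffHochschild,
      (∀ (k : ℕ) (X : multivectorFields m M k) (f : Fin k → C^∞⟮𝓡 m, M; ℝ⟯) (p : M),
        (((U.f k).T X).1 f : C^∞⟮𝓡 m, M; ℝ⟯) p =
          (1 / (k.factorial : ℝ)) * insertCovectors (fun i => covectorAt (f i) p) (X.1 p)) ∧
      (∀ (k : ℕ) (X : 𝓜.multivectorsN k) (f : Fin k → 𝓜.functionsN) (p : M),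
        (((U.f k).N X).1.2 f : 𝓜.functionsN).1 p =
          (1 / (k.factorial : ℝ)) * insertCovectors (fun i => covectorAt (f i).1 p) (X.1.1 p)) ∧
      ∀ k : ℕ, IsRegularMono (U.induced k) := by
  exact ⟨𝓜.hkrHom, fun _ _ _ _ => rfl, fun _ _ _ _ => rfl, fun k =>
    ConMod.isRegularMono_of_injective _ (𝓜.injective_induced_T k) (𝓜.injective_induced_N k)
      (𝓜.mem_zero_of_induced_N k)⟩
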